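/- Let $\rho>1$, $b=1/\rho$, let $H=\{\zeta\in\mathbb C:\operatorname{Re}\zeta>0\}$, and let $h(\zeta)=\zeta+\frac1b\zeta^b$ on $H$ (principal branch). The function $1/h'$ has an antiderivative on $H$, and for every antiderivative $G=\int \frac{1}{h'}\,d\zeta$ of $1/h'$ on $H$ the following holds. The map $z(\zeta)=h(\zeta)-\overline{G(\zeta)}$ is harmonic and univalent (injective) on $H$. Its image $D=z(H)$ is an unbounded domain contained in a half-plane $\{\operatorname{Re} w>c\}$ for some real $c$, and $D$ has asymptotic angle $\pi$, that is, $\limsup_{r\to\infty}\Theta^*(r)=\pi$, where $\Theta^*(r)$ is the angular measure of $D\cap\{|w|=r\}$ if $D$ does not contain the circle $|w|=r$, and $+\infty$ otherwise. There is a function $u$, continuous on $\overline D$ and $C^2$ in $D$, with $u(z(\zeta))=2\operatorname{Re}\zeta$ for all $\zeta\in H$, which is a nontrivial solution of $$\operatorname{div}\frac{\nabla u}{\sqrt{1+|\nabla u|^2}}=0\ \text{ and }\ u>0\ \text{ in } D,\qquad u=0\ \text{ on }\partial D,$$ and whose order of growth is $\rho$: for all large $r$ the maximum $M(r)=\max\{u(w):w\in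 D,\ |w|=r\}$ exists, and $$\limsup_{r\to\infty}\frac{\log M(r)}{\log r}=\rho .$$ Thus every order of growth $\rho\in(1,\infty)$, anywhere between linear and exponential growth, occurs for such a solution. -/

import Mathlib

open Set Filter Topology MeasureTheory

noncomputable section

/-- The open right half-plane. -/
def rightHalfPlane : Set ℂ := {ζ | 0 < ζ.re}

/-- The analytic function `h(ζ) = ζ + ζ^b / b` (principal branch of the power). -/
def hFun (b : ℝ) (ζ : ℂ) : ℂ := ζ + ζ ^ (b : ℂ) / (b : ℂ)

/-- `G` is an antiderivative `∫ 1/h'` of `1/h'` on the right half-plane. -/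
def IsAntiderivInv (h G : ℂ → ℂ) : Prop :=
  ∀ ζ ∈ rightHalfPlane, HasDerivAt G (1 / deriv h ζ) ζ

/-- The map `z = h - conj (∫ 1/h')`, for a given choice `G` of `∫ 1/h'`. -/
def zMap (h G : ℂ → ℂ) (ζ : ℂ) : ℂ := h ζ - (starRingEnd ℂ) (G ζ)

/-- Partial derivative of `u` in the direction of the real axis. -/
def partialX (u : ℂ → ℝ) (w : ℂ) : ℝ := fderiv ℝ u w 1

/-- Partial derivative of `u` in the direction of the imaginary axis. -/
def partialY (u : ℂ → ℝ) (w : ℂ) : ℝ := fderiv ℝ u w Complex.I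

/-- `√(1 + |∇u|²)`. -/
def areaDensity (u : ℂ → ℝ) (w : ℂ) : ℝ :=
  Real.sqrt (1 + (partialX u w ^ 2 + partialY u w ^ 2))

/-- `div (∇u / √(1 + |∇u|²))`. -/
def minimalSurfaceOperator (u : ℂ → ℝ) (w : ℂ) : ℝ :=
  partialX (fun v => partialX u v / areaDensity u v) w +
    partialY (fun v => partialY u v / areaDensity u v) w

/-- `u` is a positive (hence nontrivial) classical solution of the minimal surface equation
over the unbounded plane domain `D`, with zero boundary values. -/
structure IsPositiveMinimalGraph (D : Set ℂ) (u : ℂ → ℝ) : Prop where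
  isOpen : IsOpen D
  isConnected : IsConnected D
  unbounded : ¬ Bornology.IsBounded D
  contDiffOn : ContDiffOn ℝ 2 u D
  continuousOn_closure : ContinuousOn u (closure D)
  equation : ∀ w ∈ D, minimalSurfaceOperator u w = 0
  pos : ∀ w ∈ D, 0 < u w
  boundary : ∀ w ∈ frontier D, u w = 0

/-- `M(r)`: the maximum of `u` over the points of `D` on the circle `|w| = r`. -/
def maxOnCircle (D : Set ℂ) (u : ℂ → ℝ) (r : ℝ) : ℝ :=
  sSup (u '' (D ∩ Metric.sphere 0 r))

/-- The order of growth `limsup_{r → ∞} log M(r) / log r`, as an extended real number. -/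
def growthOrder (D : Set ℂ) (u : ℂ → ℝ) : EReal :=
  limsup (fun r : ℝ => ((Real.log (maxOnCircle D u r) / Real.log r : ℝ) : EReal)) atTop

/-- `Θ(r)`: the angular measure of the part of the circle `|w| = r` lying in `D`. -/
def angularMeasure (D : Set ℂ) (r : ℝ) : ENNReal :=
  volume {θ : ℝ | θ ∈ Ioc (-Real.pi) Real.pi ∧ (r : ℂ) * Complex.exp (θ * Complex.I) ∈ D}

open Classical in
/-- `Θ*(r)`: equal to `Θ(r)` unless `D` contains the whole circle `|w| = r`, and then `+∞`. -/
def angularMeasureStar (D : Set ℂ) (r : ℝ) : ENNReal :=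
  if Metric.sphere (0 : ℂ) r ⊆ D then ⊤ else angularMeasure D r

/-- The asymptotic angle `limsup_{r → ∞} Θ*(r)` of `D`. -/
def asymptoticAngle (D : Set ℂ) : ENNReal :=
  limsup (fun r : ℝ => angularMeasureStar D r) atTop

end

/-! Put `F = h' = 1 + ζ^(b-1)`. On `H` the argument of `ζ^(b-1)` is less than `π(1-b)/2` in modulus,
so `Re F > 1`; hence `|1/F| < 1`, and in `z = h - conj G` the holomorphic part dominates.
Integrating `Re (conj d · dz)` along a segment of direction `d` gives an explicit lower bound for
`|z(q) - z(p)|` (`mul_norm_sub_le_norm_zMap_sub`). As `G` is Lipschitz, `z` and this bound extend to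
the closed half-plane. There `z` is injective and proper with continuous inverse, so the frontier of
`D` lies in the image of the imaginary axis, where `u = 2 Re ζ` vanishes.

The equation is the Weierstrass representation in disguise: `∇u / √(1+|∇u|²)` is the rotated
gradient of `2 Im ζ` (`partial_div_areaDensity_heightFun`), hence divergence free.

Growth and angle follow from two estimates: `|z(ζ) - z(0)| ≥ κ|ζ|^b` with `κ > 0`
(`mul_rpow_norm_le_norm_zMap_sub`), and `z(ζ) = z(0) + 2i Im ζ + O(|ζ|^b)` (`norm_zMap_sub_le`). The
first gives `u ≤ C r^(1/b)` on `|w| = r`; the second, on the real axis, gives the matching lower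
bound. On the imaginary axis the second shows that the boundary is asymptotically vertical, so `D`
contains the far part of each sector narrower than `π`. Since `Re z` increases along rays from `0`,
`D` also lies in a half-plane, and the angle is `π`. -/

/-! ### The derivative of `h` on the half-plane -/

theorem isOpen_rightHalfPlane : IsOpen rightHalfPlane :=
  isOpen_lt continuous_const Complex.continuous_re

theorem convex_rightHalfPlane : Convex ℝ rightHalfPlane :=
  convex_halfSpace_re_gt 0

theorem mem_slitPlane_of_mem_rightHalfPlane {ζ : ℂ} (hζ : ζ ∈ rightHalfPlane) :
    ζ ∈ Complex.slitPlane := Or.inl hζ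

theorem ne_zero_of_mem_rightHalfPlane {ζ : ℂ} (hζ : ζ ∈ rightHalfPlane) : ζ ≠ 0 :=
  Complex.slitPlane_ne_zero (mem_slitPlane_of_mem_rightHalfPlane hζ)

/-- The derivative `1 + ζ ^ (b - 1)` of `hFun b`. -/
noncomputable def hSlope (b : ℝ) (ζ : ℂ) : ℂ := 1 + ζ ^ ((b : ℂ) - 1)

theorem hasDerivAt_hFun {b : ℝ} (hb : b ≠ 0) {ζ : ℂ} (hζ : ζ ∈ rightHalfPlane) :
    HasDerivAt (hFun b) (hSlope b ζ) ζ := by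
  have h := ((hasDerivAt_id ζ).cpow_const (c := (b : ℂ))
    (mem_slitPlane_of_mem_rightHalfPlane hζ)).div_const (b : ℂ)
  refine ((hasDerivAt_id ζ).add h).congr_deriv ?_
  have : (b : ℂ) ≠ 0 := by exact_mod_cast hb
  simp only [hSlope, id]
  field_simp

theorem deriv_hFun {b : ℝ} (hb : b ≠ 0) {ζ : ℂ} (hζ : ζ ∈ rightHalfPlane) :
    deriv (hFun b) ζ = hSlope b ζ := (hasDerivAt_hFun hb hζ).deriv

theorem norm_cpow_sub_one {b : ℝ} {ζ : ℂ} (hζ : ζ ≠ 0) :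
    ‖ζ ^ ((b : ℂ) - 1)‖ = ‖ζ‖ ^ (b - 1) := by
  rw [show ((b : ℂ) - 1) = ((b - 1 : ℝ) : ℂ) by push_cast; rfl, Complex.norm_cpow_of_ne_zero hζ]
  simp

theorem abs_arg_lt_of_mem {ζ : ℂ} (hζ : ζ ∈ rightHalfPlane) : |ζ.arg| < Real.pi / 2 :=
  Complex.abs_arg_lt_pi_div_two_iff.2 (Or.inl hζ)

/-- The lower bound constant for `Re (ζ ^ (b - 1)) / |ζ| ^ (b - 1)` on the right half-plane. -/
noncomputable def angleConst (b : ℝ) : ℝ := Real.cos (Real.pi / 2 * (1 - b))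

theorem angleConst_pos {b : ℝ} (hb0 : 0 < b) (hb1 : b < 1) : 0 < angleConst b := by
  apply Real.cos_pos_of_mem_Ioo
  constructor <;> nlinarith [Real.pi_pos]

/-- The argument of the power is `(b-1) arg ζ`, at most `π(1-b)/2 < π/2` in modulus, and cosine
decreases on `[0, π]`. -/
theorem angleConst_mul_rpow_le_re_cpow {b : ℝ} (hb0 : 0 < b) (hb1 : b < 1) {ζ : ℂ}
    (hζ : ζ ∈ rightHalfPlane) :
    angleConst b * ‖ζ‖ ^ (b - 1) ≤ (ζ ^ ((b : ℂ) - 1)).re := by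
  rw [show ((b : ℂ) - 1) = ((b - 1 : ℝ) : ℂ) by push_cast; rfl, Complex.cpow_ofReal_re, mul_comm]
  gcongr
  have h := (abs_arg_lt_of_mem hζ).le
  rw [← Real.cos_abs (ζ.arg * (b - 1)), abs_mul, abs_of_neg (sub_neg.2 hb1), neg_sub]
  apply Real.cos_le_cos_of_nonneg_of_le_pi
  · have := abs_nonneg ζ.arg
    exact mul_nonneg this (by linarith)
  · nlinarith [Real.pi_pos]
  · gcongr

theorem re_cpow_sub_one_pos {b : ℝ} (hb0 : 0 < b) (hb1 : b < 1) {ζ : ℂ}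
    (hζ : ζ ∈ rightHalfPlane) : 0 < (ζ ^ ((b : ℂ) - 1)).re :=
  (mul_pos (angleConst_pos hb0 hb1)
    (Real.rpow_pos_of_pos (norm_pos_iff.2 (ne_zero_of_mem_rightHalfPlane hζ)) _)).trans_le
    (angleConst_mul_rpow_le_re_cpow hb0 hb1 hζ)

theorem re_cpow_pos {b : ℝ} (hb0 : 0 < b) (hb1 : b < 1) {ζ : ℂ}
    (hζ : ζ ∈ rightHalfPlane) : 0 < (ζ ^ (b : ℂ)).re := by
  rw [Complex.cpow_ofReal_re]
  have h := abs_lt.1 (abs_arg_lt_of_mem hζ)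
  apply mul_pos (Real.rpow_pos_of_pos (norm_pos_iff.2 (ne_zero_of_mem_rightHalfPlane hζ)) _)
  apply Real.cos_pos_of_mem_Ioo
  constructor <;> nlinarith [Real.pi_pos]

theorem one_lt_norm_hSlope {b : ℝ} (hb0 : 0 < b) (hb1 : b < 1) {ζ : ℂ}
    (hζ : ζ ∈ rightHalfPlane) : 1 < ‖hSlope b ζ‖ := by
  refine lt_of_lt_of_le ?_ (Complex.re_le_norm _)
  have := re_cpow_sub_one_pos hb0 hb1 hζ
  simpa [hSlope] using this

theorem hSlope_ne_zero {b : ℝ} (hb0 : 0 < b) (hb1 : b < 1) {ζ : ℂ}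
    (hζ : ζ ∈ rightHalfPlane) : hSlope b ζ ≠ 0 :=
  norm_pos_iff.1 (zero_lt_one.trans (one_lt_norm_hSlope hb0 hb1 hζ))

theorem norm_one_div_hSlope_le {b : ℝ} (hb0 : 0 < b) (hb1 : b < 1) {ζ : ℂ}
    (hζ : ζ ∈ rightHalfPlane) : ‖1 / hSlope b ζ‖ ≤ 1 := by
  rw [norm_div, norm_one]
  exact (div_le_one (norm_pos_iff.2 (hSlope_ne_zero hb0 hb1 hζ))).2
    (one_lt_norm_hSlope hb0 hb1 hζ).le

theorem norm_one_div_hSlope_sub_one_le {b : ℝ} (hb0 : 0 < b) (hb1 : b < 1) {ζ : ℂ}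
    (hζ : ζ ∈ rightHalfPlane) : ‖1 / hSlope b ζ - 1‖ ≤ ‖ζ‖ ^ (b - 1) := by
  have h0 := hSlope_ne_zero hb0 hb1 hζ
  have : 1 / hSlope b ζ - 1 = -(ζ ^ ((b : ℂ) - 1)) * (1 / hSlope b ζ) := by
    field_simp
    simp [hSlope]
  rw [this, norm_mul, norm_neg, norm_cpow_sub_one (ne_zero_of_mem_rightHalfPlane hζ)]
  exact mul_le_of_le_one_right (by positivity) (norm_one_div_hSlope_le hb0 hb1 hζ)

/-! ### Antiderivatives of `1/h'` and their continuous extension -/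

theorem IsAntiderivInv.hasDerivAt {b : ℝ} (hb0 : 0 < b) {G : ℂ → ℂ}
    (hG : IsAntiderivInv (hFun b) G) {ζ : ℂ} (hζ : ζ ∈ rightHalfPlane) :
    HasDerivAt G (1 / hSlope b ζ) ζ := by
  simpa only [deriv_hFun hb0.ne' hζ] using hG ζ hζ

/-- A holomorphic function on the right half-plane has a primitive there. -/
theorem DifferentiableOn.exists_primitive_rightHalfPlane {g : ℂ → ℂ}
    (hg : DifferentiableOn ℂ g rightHalfPlane) :
    ∃ G : ℂ → ℂ, ∀ ζ ∈ rightHalfPlane, HasDerivAt G (g ζ) ζ := by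
  -- The Cayley transform from the unit disc to `H`: the pulled-back form `g(φ) φ'` has a primitive
  -- on a disc, which is then composed with `φ⁻¹`.
  let φ : ℂ → ℂ := fun w => (1 + w) / (1 - w)
  have hball : ∀ w ∈ Metric.ball (0 : ℂ) 1, 1 - w ≠ 0 := by
    intro w hw h
    rw [mem_ball_zero_iff, ← sub_eq_zero.1 h] at hw
    simp at hw
  have hmaps : MapsTo φ (Metric.ball 0 1) rightHalfPlane := by
    intro w hw
    have h0 := hball w hw
    rw [mem_ball_zero_iff, ← sq_lt_one_iff₀ (norm_nonneg _), Complex.sq_norm,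
      Complex.normSq_apply] at hw
    have : (φ w).re = (1 - (w.re * w.re + w.im * w.im)) / Complex.normSq (1 - w) := by
      have := (Complex.normSq_pos.2 h0).ne'
      simp only [φ, Complex.div_re]
      field_simp
      simp
      ring
    change 0 < (φ w).re
    rw [this]
    exact div_pos (by linarith) (Complex.normSq_pos.2 h0)
  have hφ : ∀ w ∈ Metric.ball (0 : ℂ) 1, HasDerivAt φ (2 / (1 - w) ^ 2) w := by
    intro w hw
    have h0 := hball w hw
    refine (((hasDerivAt_id w).const_add 1).div ((hasDerivAt_id w).const_sub 1) h0).congr_deriv ?_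
    simp only [id]
    field_simp
    ring
  have hd : DifferentiableOn ℂ (fun w => g (φ w) * (2 / (1 - w) ^ 2)) (Metric.ball 0 1) := by
    refine DifferentiableOn.mul
      (hg.comp (fun w hw => (hφ w hw).differentiableAt.differentiableWithinAt) hmaps) ?_
    intro w hw
    have h0 := hball w hw
    have : (1 - w) ^ 2 ≠ 0 := pow_ne_zero _ h0
    exact DifferentiableAt.differentiableWithinAt (by fun_prop (disch := assumption))
  obtain ⟨F, hF⟩ := hd.isExactOn_ball
  refine ⟨fun ζ => F ((ζ - 1) / (ζ + 1)), fun ζ hζ => ?_⟩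
  have hζ1 : ζ + 1 ≠ 0 := by
    intro h
    have := congrArg Complex.re h
    have h' : 0 < ζ.re := hζ
    simp at this
    linarith
  have hmem : (ζ - 1) / (ζ + 1) ∈ Metric.ball (0 : ℂ) 1 := by
    rw [mem_ball_zero_iff, norm_div, div_lt_one (norm_pos_iff.2 hζ1),
      ← sq_lt_sq₀ (norm_nonneg _) (norm_nonneg _), Complex.sq_norm, Complex.sq_norm,
      Complex.normSq_apply, Complex.normSq_apply]
    have h' : 0 < ζ.re := hζ
    simp
    nlinarith
  have hψ : HasDerivAt (fun ζ : ℂ => (ζ - 1) / (ζ + 1)) (2 / (ζ + 1) ^ 2) ζ := by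
    refine (((hasDerivAt_id ζ).sub_const 1).div ((hasDerivAt_id ζ).add_const 1) hζ1).congr_deriv ?_
    simp only [id]
    field_simp
    ring
  refine (HasDerivAt.comp ζ (hF _ hmem) hψ).congr_deriv ?_
  have e1 : 1 - (ζ - 1) / (ζ + 1) = 2 / (ζ + 1) := by field_simp; ring
  have e2 : φ ((ζ - 1) / (ζ + 1)) = ζ := by
    simp only [φ, e1]
    field_simp
    ring
  simp only [e2, e1]
  field_simp

theorem differentiableAt_hSlope {b : ℝ} {ζ : ℂ} (hζ : ζ ∈ rightHalfPlane) :
    DifferentiableAt ℂ (hSlope b) ζ :=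
  (differentiableAt_const _).add
    (differentiableAt_id.cpow_const (mem_slitPlane_of_mem_rightHalfPlane hζ))

theorem exists_isAntiderivInv {b : ℝ} (hb0 : 0 < b) (hb1 : b < 1) :
    ∃ G : ℂ → ℂ, IsAntiderivInv (hFun b) G := by
  have : DifferentiableOn ℂ (fun ζ => 1 / hSlope b ζ) rightHalfPlane := fun ζ hζ =>
    ((differentiableAt_const _).div (differentiableAt_hSlope hζ)
      (hSlope_ne_zero hb0 hb1 hζ)).differentiableWithinAt
  obtain ⟨G, hG⟩ := this.exists_primitive_rightHalfPlane
  exact ⟨G, fun ζ hζ => by simpa only [deriv_hFun hb0.ne' hζ] using hG ζ hζ⟩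

theorem IsAntiderivInv.congr {h G G' : ℂ → ℂ} (hG : IsAntiderivInv h G)
    (he : EqOn G G' rightHalfPlane) : IsAntiderivInv h G' := fun ζ hζ =>
  (hG ζ hζ).congr_of_eventuallyEq
    ((he.eventuallyEq_of_mem (isOpen_rightHalfPlane.mem_nhds hζ)).symm)

/-- An antiderivative of `1 / h'` agrees with a function that is continuous on the whole plane. -/
theorem IsAntiderivInv.exists_continuous {b : ℝ} (hb0 : 0 < b) (hb1 : b < 1) {G : ℂ → ℂ}
    (hG : IsAntiderivInv (hFun b) G) :
    ∃ G' : ℂ → ℂ, Continuous G' ∧ EqOn G G' rightHalfPlane := by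
  -- `|G'| ≤ 1` on a convex set makes `G` Lipschitz, and a Lipschitz map extends to the whole plane.
  have hL : LipschitzOnWith 1 G rightHalfPlane :=
    convex_rightHalfPlane.lipschitzOnWith_of_nnnorm_hasDerivWithin_le (𝕜 := ℂ)
      (fun ζ hζ => (hG.hasDerivAt hb0 hζ).hasDerivWithinAt)
      (fun ζ hζ => norm_one_div_hSlope_le hb0 hb1 hζ)
  obtain ⟨G', h1, h2⟩ := hL.extend_finite_dimension
  exact ⟨G', h1.continuous, h2⟩

/-! ### Quantitative injectivity -/

theorem hasDerivAt_zMap_line {b : ℝ} (hb0 : 0 < b) {G : ℂ → ℂ}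
    (hG : IsAntiderivInv (hFun b) G) {p d : ℂ} {t : ℝ} (ht : p + t * d ∈ rightHalfPlane) :
    HasDerivAt (fun t : ℝ => zMap (hFun b) G (p + t * d))
      (hSlope b (p + t * d) * d - (starRingEnd ℂ) (1 / hSlope b (p + t * d) * d)) t := by
  have hl : HasDerivAt (fun t : ℝ => p + (t : ℂ) * d) d t := by
    simpa using ((Complex.ofRealCLM.hasDerivAt (x := t)).mul_const d).const_add p
  have h1 := (hasDerivAt_hFun hb0.ne' ht).comp t hl
  have h2 := (hG.hasDerivAt hb0 ht).comp t hl
  exact h1.sub (Complex.conjCLE.toContinuousLinearMap.hasFDerivAt.comp_hasDerivAt t h2)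

theorem re_le_of_norm_le_one {d g : ℂ} (hg : ‖g‖ ≤ 1) :
    ((starRingEnd ℂ) d * (starRingEnd ℂ) (g * d)).re ≤ ‖d‖ ^ 2 := by
  refine (Complex.re_le_norm _).trans ?_
  rw [norm_mul, RCLike.norm_conj, RCLike.norm_conj, norm_mul, pow_two]
  gcongr
  exact mul_le_of_le_one_left (norm_nonneg _) hg

/-- Along the segment, the component of `z` in direction `d = q - p` has derivative at least `(Re F
- 1)|d|²`, because `|1/F| ≤ 1`. The excess `Re F - 1 = Re ζ^(b-1)` is at least `κ R^(b-1)`, as the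
exponent is negative and `|ζ| ≤ R`. -/
theorem mul_norm_sub_le_norm_zMap_sub {b : ℝ} (hb0 : 0 < b) (hb1 : b < 1) {G : ℂ → ℂ}
    (hG : IsAntiderivInv (hFun b) G) {R : ℝ} {p q : ℂ} (hp : p ∈ rightHalfPlane)
    (hq : q ∈ rightHalfPlane) (hpR : ‖p‖ ≤ R) (hqR : ‖q‖ ≤ R) :
    angleConst b * R ^ (b - 1) * ‖q - p‖ ≤ ‖zMap (hFun b) G q - zMap (hFun b) G p‖ := by
  set d := q - p with hd
  rcases eq_or_ne d 0 with h0 | h0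
  · simp [h0]
  set L : ℂ →L[ℝ] ℝ := Complex.reCLM.comp (((ContinuousLinearMap.mul ℝ ℂ) ((starRingEnd ℂ) d)))
    with hL
  have hmem : ∀ t ∈ Icc (0 : ℝ) 1, p + t * d ∈ rightHalfPlane ∧ ‖p + t * d‖ ≤ R := by
    intro t ht
    have hc := (convex_rightHalfPlane.inter (convex_closedBall (0 : ℂ) R)).add_smul_sub_mem
      ⟨hp, by simpa using hpR⟩ ⟨hq, by simpa using hqR⟩ ht
    simpa [hd] using hc
  have hder : ∀ t ∈ Icc (0 : ℝ) 1, HasDerivAt (fun t : ℝ => L (zMap (hFun b) G (p + t * d)))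
      (L (hSlope b (p + t * d) * d - (starRingEnd ℂ) (1 / hSlope b (p + t * d) * d))) t :=
    fun t ht => L.hasFDerivAt.comp_hasDerivAt t (hasDerivAt_zMap_line hb0 hG (hmem t ht).1)
  have hmv := (convex_Icc (0 : ℝ) 1).mul_sub_le_image_sub_of_le_deriv
    (C := angleConst b * R ^ (b - 1) * ‖d‖ ^ 2)
    (fun t ht => (hder t ht).continuousAt.continuousWithinAt)
    (fun t ht => (hder t (interior_subset ht)).differentiableAt.differentiableWithinAt)
    (fun t ht => ?_) 0 (by simp) 1 (by simp) zero_le_one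
  · have e : L (zMap (hFun b) G (p + (1 : ℝ) * d)) - L (zMap (hFun b) G (p + (0 : ℝ) * d)) ≤
        ‖d‖ * ‖zMap (hFun b) G q - zMap (hFun b) G p‖ := by
      rw [← map_sub]
      refine (Complex.re_le_norm _).trans ?_
      change ‖(starRingEnd ℂ) d * _‖ ≤ _
      rw [norm_mul, RCLike.norm_conj]
      simp [hd]
    have := hmv.trans e
    refine le_of_mul_le_mul_left ?_ (norm_pos_iff.2 h0)
    linarith
  · have ht' := interior_subset ht
    obtain ⟨hH, hR⟩ := hmem t ht'
    rw [(hder t ht').deriv]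
    set ζ := p + t * d
    have h1 := re_le_of_norm_le_one (d := d) (norm_one_div_hSlope_le hb0 hb1 hH)
    have h2 : ((starRingEnd ℂ) d * (hSlope b ζ * d)).re = (hSlope b ζ).re * ‖d‖ ^ 2 := by
      rw [Complex.sq_norm, Complex.normSq_apply]
      simp
      ring
    have h3 : 1 + angleConst b * R ^ (b - 1) ≤ (hSlope b ζ).re := by
      have h4 := angleConst_mul_rpow_le_re_cpow hb0 hb1 hH
      have h5 : R ^ (b - 1) ≤ ‖ζ‖ ^ (b - 1) :=
        Real.rpow_le_rpow_of_nonpos (norm_pos_iff.2 (ne_zero_of_mem_rightHalfPlane hH)) hR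
          (by linarith)
      have h6 := mul_le_mul_of_nonneg_left h5 (angleConst_pos hb0 hb1).le
      simp only [hSlope, Complex.add_re, Complex.one_re]
      linarith
    have h7 := mul_le_mul_of_nonneg_right h3 (sq_nonneg ‖d‖)
    simp only [hL, ContinuousLinearMap.comp_apply, ContinuousLinearMap.mul_apply',
      Complex.reCLM_apply, mul_sub, Complex.sub_re, h2]
    linarith

theorem injOn_zMap {b : ℝ} (hb0 : 0 < b) (hb1 : b < 1) {G : ℂ → ℂ}
    (hG : IsAntiderivInv (hFun b) G) : InjOn (zMap (hFun b) G) rightHalfPlane := by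
  intro p hp q hq h
  have hpos : 0 < max ‖p‖ ‖q‖ :=
    (norm_pos_iff.2 (ne_zero_of_mem_rightHalfPlane hp)).trans_le (le_max_left _ _)
  have := mul_norm_sub_le_norm_zMap_sub hb0 hb1 hG hp hq (le_max_left _ _) (le_max_right _ _)
  rw [h, sub_self, norm_zero] at this
  have hc := mul_pos (angleConst_pos hb0 hb1) (Real.rpow_pos_of_pos hpos (b - 1))
  exact (sub_eq_zero.1 (norm_le_zero_iff.1 (nonpos_of_mul_nonpos_right this hc))).symm

/-! ### Passage to the closed half-plane -/

/-- The closed right half-plane. -/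
def closedRightHalfPlane : Set ℂ := {ζ | 0 ≤ ζ.re}

theorem rightHalfPlane_subset : rightHalfPlane ⊆ closedRightHalfPlane := 
  fun _ (h : 0 < Complex.re _) => h.le

theorem zero_mem_closedRightHalfPlane : (0 : ℂ) ∈ closedRightHalfPlane := le_refl (0 : ℝ)

theorem isClosed_closedRightHalfPlane : IsClosed closedRightHalfPlane :=
  isClosed_le continuous_const Complex.continuous_re

theorem add_ofReal_mem {ζ : ℂ} (hζ : ζ ∈ closedRightHalfPlane) {ε : ℝ} (hε : 0 < ε) :
    ζ + ε ∈ rightHalfPlane := by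
  have : 0 ≤ ζ.re := hζ
  change 0 < (ζ + ε).re
  simp
  linarith

theorem continuousOn_hFun {b : ℝ} (hb0 : 0 < b) :
    ContinuousOn (hFun b) closedRightHalfPlane := by
  intro ζ hζ
  refine ContinuousAt.continuousWithinAt ?_
  have : ContinuousAt (fun ζ : ℂ => ζ ^ (b : ℂ)) ζ :=
    Complex.continuousAt_cpow_const_of_re_pos (Or.inl hζ) (by simpa)
  exact continuousAt_id.add (this.div_const _)

theorem continuousOn_zMap {b : ℝ} (hb0 : 0 < b) {G : ℂ → ℂ} (hc : Continuous G) :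
    ContinuousOn (zMap (hFun b) G) closedRightHalfPlane :=
  (continuousOn_hFun hb0).sub (Complex.continuous_conj.comp hc).continuousOn

theorem tendsto_add_ofReal {f : ℂ → ℂ} (hf : ContinuousOn f closedRightHalfPlane) {ζ : ℂ}
    (hζ : ζ ∈ closedRightHalfPlane) :
    Tendsto (fun ε : ℝ => f (ζ + ε)) (𝓝[>] 0) (𝓝 (f ζ)) := by
  refine (hf ζ hζ).tendsto.comp (tendsto_nhdsWithin_iff.2 ⟨?_, ?_⟩)
  · have : Continuous fun ε : ℝ => ζ + (ε : ℂ) := by fun_prop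
    simpa using (this.tendsto 0).mono_left nhdsWithin_le_nhds
  · filter_upwards [self_mem_nhdsWithin] with ε hε
    exact rightHalfPlane_subset (add_ofReal_mem hζ hε)

/-- Apply the open case to `p + ε`, `q + ε` with radius `R + ε` and let `ε → 0⁺`. -/
theorem mul_norm_sub_le_norm_zMap_sub_of_closed {b : ℝ} (hb0 : 0 < b) (hb1 : b < 1) {G : ℂ → ℂ}
    (hG : IsAntiderivInv (hFun b) G) (hc : Continuous G) {R : ℝ} (hR : 0 < R) {p q : ℂ}
    (hp : p ∈ closedRightHalfPlane) (hq : q ∈ closedRightHalfPlane) (hpR : ‖p‖ ≤ R)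
    (hqR : ‖q‖ ≤ R) :
    angleConst b * R ^ (b - 1) * ‖q - p‖ ≤ ‖zMap (hFun b) G q - zMap (hFun b) G p‖ := by
  have hz := continuousOn_zMap hb0 hc
  have h1 := ((tendsto_add_ofReal hz hq).sub (tendsto_add_ofReal hz hp)).norm
  have h2 : Tendsto (fun ε : ℝ => angleConst b * (R + ε) ^ (b - 1) * ‖q - p‖) (𝓝[>] 0)
      (𝓝 (angleConst b * R ^ (b - 1) * ‖q - p‖)) := by
    have : ContinuousAt (fun ε : ℝ => angleConst b * (R + ε) ^ (b - 1) * ‖q - p‖) 0 := by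
      have : ContinuousAt (fun ε : ℝ => (R + ε) ^ (b - 1)) 0 :=
        (continuousAt_const.add continuousAt_id).rpow_const (Or.inl (by simpa using hR.ne'))
      fun_prop
    simpa using this.tendsto.mono_left nhdsWithin_le_nhds
  refine le_of_tendsto_of_tendsto h2 h1 ?_
  filter_upwards [self_mem_nhdsWithin] with ε (hε : 0 < ε)
  have hn : ∀ x : ℂ, ‖x‖ ≤ R → ‖x + ε‖ ≤ R + ε := fun x hx => by
    refine (norm_add_le _ _).trans ?_
    rw [Complex.norm_real, Real.norm_of_nonneg hε.le]
    linarith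
  simpa using mul_norm_sub_le_norm_zMap_sub hb0 hb1 hG (add_ofReal_mem hp hε)
    (add_ofReal_mem hq hε) (hn p hpR) (hn q hqR)

theorem injOn_zMap_closed {b : ℝ} (hb0 : 0 < b) (hb1 : b < 1) {G : ℂ → ℂ}
    (hG : IsAntiderivInv (hFun b) G) (hc : Continuous G) :
    InjOn (zMap (hFun b) G) closedRightHalfPlane := by
  intro p hp q hq h
  -- The extra `1` keeps the radius positive when both points are `0`.
  have hpos : 0 < max ‖p‖ ‖q‖ + 1 := by positivity
  have := mul_norm_sub_le_norm_zMap_sub_of_closed hb0 hb1 hG hc hpos hp hq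
    ((le_max_left _ _).trans (by linarith)) ((le_max_right _ _).trans (by linarith))
  rw [h, sub_self, norm_zero] at this
  have hc := mul_pos (angleConst_pos hb0 hb1) (Real.rpow_pos_of_pos hpos (b - 1))
  exact (sub_eq_zero.1 (norm_le_zero_iff.1 (nonpos_of_mul_nonpos_right this hc))).symm

/-- The case `p = 0`, `R = |ζ|` of the previous bound. It makes `z` proper and limits the growth of
`u` from above. -/
theorem mul_rpow_norm_le_norm_zMap_sub {b : ℝ} (hb0 : 0 < b) (hb1 : b < 1) {G : ℂ → ℂ}
    (hG : IsAntiderivInv (hFun b) G) (hc : Continuous G) {ζ : ℂ}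
    (hζ : ζ ∈ closedRightHalfPlane) :
    angleConst b * ‖ζ‖ ^ b ≤ ‖zMap (hFun b) G ζ - zMap (hFun b) G 0‖ := by
  rcases eq_or_ne ζ 0 with rfl | h0
  · simp [Real.zero_rpow hb0.ne']
  have hp := norm_pos_iff.2 h0
  have := mul_norm_sub_le_norm_zMap_sub_of_closed hb0 hb1 hG hc hp zero_mem_closedRightHalfPlane hζ
    (by simp) le_rfl
  rw [sub_zero, mul_assoc, ← Real.rpow_add_one hp.ne'] at this
  simpa using this

/-! ### Asymptotics of `z` and monotonicity along rays -/

theorem continuousOn_ray {f : ℂ → ℂ}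
    (hf : ContinuousOn f closedRightHalfPlane) {ζ : ℂ} (hζ : ζ ∈ closedRightHalfPlane) :
    ContinuousOn (fun t : ℝ => f (t * ζ)) (Ici 0) := by
  refine hf.comp (by fun_prop) fun t ht => ?_
  have h1 : 0 ≤ ζ.re := hζ
  have h2 : 0 ≤ t := ht
  change 0 ≤ (t * ζ).re
  simpa using mul_nonneg h2 h1

theorem ofReal_mul_mem {ζ : ℂ} (hζ : ζ ∈ rightHalfPlane) {t : ℝ} (ht : 0 < t) :
    t * ζ ∈ rightHalfPlane := by
  change 0 < (t * ζ).re
  simpa using mul_pos ht hζ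

/-- The antiderivative stays within `|ζ| ^ b / b` of the identity, up to its value at `0`. -/
theorem norm_antideriv_sub_le {b : ℝ} (hb0 : 0 < b) (hb1 : b < 1) {G : ℂ → ℂ}
    (hG : IsAntiderivInv (hFun b) G) (hc : Continuous G) {ζ : ℂ}
    (hζ : ζ ∈ rightHalfPlane) : ‖G ζ - ζ - G 0‖ ≤ ‖ζ‖ ^ b / b := by
  have hζ0 := norm_pos_iff.2 (ne_zero_of_mem_rightHalfPlane hζ)
  -- The integral of `|1/F - 1| ≤ |tζ|^(b-1)` is compared with its primitive in `t`; starting at `s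
  -- > 0` avoids the singularity at `0`, and `s → 0⁺` comes afterwards.
  have key : ∀ s ∈ Ioc (0 : ℝ) 1,
      ‖(G ζ - ζ) - (G (s * ζ) - s * ζ)‖ ≤ ‖ζ‖ ^ b / b * (1 - s ^ b) := by
    intro s hs
    have hder : ∀ t ∈ Icc s 1, HasDerivAt (fun t : ℝ => G (t * ζ) - t * ζ - (G (s * ζ) - s * ζ))
        ((1 / hSlope b (t * ζ) - 1) * ζ) t := by
      intro t ht
      have hl : HasDerivAt (fun t : ℝ => (t : ℂ) * ζ) ζ t := by
        simpa using (Complex.ofRealCLM.hasDerivAt (x := t)).mul_const ζ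
      have := ((hG.hasDerivAt hb0 (ofReal_mul_mem hζ (hs.1.trans_le ht.1))).comp t hl).sub hl
      refine (this.sub_const _).congr_deriv ?_
      ring
    have hderB : ∀ t ∈ Icc s 1, HasDerivAt (fun t : ℝ => ‖ζ‖ ^ b / b * (t ^ b - s ^ b))
        (‖ζ‖ ^ b * t ^ (b - 1)) t := by
      intro t ht
      have := ((Real.hasDerivAt_rpow_const (p := b) (Or.inl (hs.1.trans_le ht.1).ne')).sub_const
        (s ^ b)).const_mul (‖ζ‖ ^ b / b)
      refine this.congr_deriv ?_
      field_simp
    have := image_norm_le_of_norm_deriv_right_le_deriv_boundary'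
      (fun t ht => (hder t ht).continuousAt.continuousWithinAt)
      (fun t ht => (hder t (Ico_subset_Icc_self ht)).hasDerivWithinAt) (by simp)
      (fun t ht => (hderB t ht).continuousAt.continuousWithinAt)
      (fun t ht => (hderB t (Ico_subset_Icc_self ht)).hasDerivWithinAt) ?_ (right_mem_Icc.2 hs.2)
    · simpa using this
    · intro t ht
      have ht0 := hs.1.trans_le ht.1
      rw [norm_mul]
      have h1 := norm_one_div_hSlope_sub_one_le hb0 hb1 (ofReal_mul_mem hζ ht0)
      rw [norm_mul, Complex.norm_real, Real.norm_of_nonneg ht0.le,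
        Real.mul_rpow ht0.le hζ0.le] at h1
      refine (mul_le_mul_of_nonneg_right h1 hζ0.le).trans_eq ?_
      rw [mul_assoc, ← Real.rpow_add_one hζ0.ne', sub_add_cancel, mul_comm]
  have hl : Tendsto (fun s : ℝ => ‖(G ζ - ζ) - (G (s * ζ) - s * ζ)‖) (𝓝[>] 0)
      (𝓝 ‖G ζ - ζ - G 0‖) := by
    have : Continuous (fun s : ℝ => ‖(G ζ - ζ) - (G (s * ζ) - s * ζ)‖) := by fun_prop
    simpa using (this.tendsto 0).mono_left nhdsWithin_le_nhds
  refine le_of_tendsto hl ?_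
  filter_upwards [Ioc_mem_nhdsGT zero_lt_one] with s hs
  refine (key s hs).trans (mul_le_of_le_one_right (by positivity) ?_)
  have := Real.rpow_nonneg hs.1.le b
  linarith

/-- The linear parts of `h` and `conj G` combine to `ζ - conj ζ = 2i Im ζ`. What remains is `ζ^b/b`
and `conj (G ζ - ζ - G 0)`, each at most `|ζ|^b / b`. -/
theorem norm_zMap_sub_le {b : ℝ} (hb0 : 0 < b) (hb1 : b < 1) {G : ℂ → ℂ}
    (hG : IsAntiderivInv (hFun b) G) (hc : Continuous G) {ζ : ℂ}
    (hζ : ζ ∈ closedRightHalfPlane) :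
    ‖zMap (hFun b) G ζ - zMap (hFun b) G 0 - 2 * ζ.im * Complex.I‖ ≤ 2 / b * ‖ζ‖ ^ b := by
  have open_case : ∀ ζ ∈ rightHalfPlane,
      ‖zMap (hFun b) G ζ - zMap (hFun b) G 0 - 2 * ζ.im * Complex.I‖ ≤ 2 / b * ‖ζ‖ ^ b := by
    intro ζ hζ
    have hb : (b : ℂ) ≠ 0 := by exact_mod_cast hb0.ne'
    have e : zMap (hFun b) G ζ - zMap (hFun b) G 0 - 2 * ζ.im * Complex.I =
        ζ ^ (b : ℂ) / b - (starRingEnd ℂ) (G ζ - ζ - G 0) := by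
      have : ζ - (starRingEnd ℂ) ζ = 2 * ζ.im * Complex.I := by
        rw [Complex.sub_conj]; push_cast; ring
      simp only [zMap, hFun, map_sub, Complex.zero_cpow hb, ← this]
      ring
    rw [e]
    refine (norm_sub_le _ _).trans ?_
    rw [RCLike.norm_conj, norm_div, Complex.norm_real, Real.norm_of_nonneg hb0.le,
      Complex.norm_cpow_of_ne_zero (ne_zero_of_mem_rightHalfPlane hζ)]
    have := norm_antideriv_sub_le hb0 hb1 hG hc hζ
    have e2 : 2 / b * ‖ζ‖ ^ b = ‖ζ‖ ^ b / b + ‖ζ‖ ^ b / b := by ring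
    rw [e2]
    simpa using this
  have h1 : ContinuousOn (fun ζ : ℂ =>
      zMap (hFun b) G ζ - zMap (hFun b) G 0 - 2 * ζ.im * Complex.I) closedRightHalfPlane := by
    have := continuousOn_zMap hb0 hc
    have h : Continuous fun ζ : ℂ => 2 * (ζ.im : ℂ) * Complex.I := by fun_prop
    exact (this.sub continuousOn_const).sub h.continuousOn
  have h2 : ContinuousOn (fun ζ : ℂ => ((2 / b * ‖ζ‖ ^ b : ℝ) : ℂ)) closedRightHalfPlane := by
    have : Continuous fun ζ : ℂ => ‖ζ‖ ^ b := continuous_norm.rpow_const fun _ => Or.inr hb0.le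
    exact Continuous.continuousOn (by fun_prop)
  have l1 := (tendsto_add_ofReal h1 hζ).norm
  have l2 := (Complex.continuous_re.tendsto _).comp (tendsto_add_ofReal h2 hζ)
  refine le_of_tendsto_of_tendsto l1 l2 ?_
  filter_upwards [self_mem_nhdsWithin] with ε hε
  exact open_case _ (add_ofReal_mem hζ hε)

/-- Conjugation does not affect the real part. With `s = ζ^(b-1)`, `F - 1/F = s + (s +
|s|²)/|1+s|²`; multiplied by `ζ`, this is a positive combination of `ζ^b` and `ζ`, both with
positive real part. -/
theorem re_mul_hSlope_sub_pos {b : ℝ} (hb0 : 0 < b) (hb1 : b < 1) {ζ : ℂ}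
    (hζ : ζ ∈ rightHalfPlane) :
    0 < (hSlope b ζ * ζ - (starRingEnd ℂ) (1 / hSlope b ζ * ζ)).re := by
  have h0 := ne_zero_of_mem_rightHalfPlane hζ
  have hs := hSlope_ne_zero hb0 hb1 hζ
  have h1 := re_cpow_pos hb0 hb1 hζ
  set s := ζ ^ ((b : ℂ) - 1) with hsdef
  have hbs : ζ ^ (b : ℂ) = s * ζ := by
    rw [hsdef, Complex.cpow_sub _ _ h0, Complex.cpow_one, div_mul_cancel₀ _ h0]
  have hf : hSlope b ζ = 1 + s := rfl
  rw [hf] at hs ⊢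
  rw [hbs] at h1
  have e1 : (1 + s) * ζ - 1 / (1 + s) * ζ =
      s * ζ + (s * ζ + (Complex.normSq s : ℂ) * ζ) * (((Complex.normSq (1 + s))⁻¹ : ℝ) : ℂ) := by
    have hn : (Complex.normSq (1 + s) : ℂ) = (1 + s) * (starRingEnd ℂ) (1 + s) :=
      (Complex.mul_conj _).symm
    have hc : (starRingEnd ℂ) (1 + s) ≠ 0 := (map_ne_zero _).2 hs
    rw [Complex.ofReal_inv, hn, ← Complex.mul_conj s]
    rw [map_add, map_one] at hc ⊢
    field_simp
    ring
  have e2 : ((1 + s) * ζ - (starRingEnd ℂ) (1 / (1 + s) * ζ)).re =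
      ((1 + s) * ζ - 1 / (1 + s) * ζ).re := by
    simp only [Complex.sub_re, Complex.conj_re]
  rw [e2, e1, Complex.add_re, Complex.re_mul_ofReal, Complex.add_re, Complex.re_ofReal_mul]
  have hz : 0 < ζ.re := hζ
  have := Complex.normSq_nonneg s
  have := Complex.normSq_nonneg (1 + s)
  positivity

theorem re_zMap_zero_le {b : ℝ} (hb0 : 0 < b) (hb1 : b < 1) {G : ℂ → ℂ}
    (hG : IsAntiderivInv (hFun b) G) (hc : Continuous G) {ζ : ℂ}
    (hζ : ζ ∈ rightHalfPlane) : (zMap (hFun b) G 0).re ≤ (zMap (hFun b) G ζ).re := by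
  have hcont : ContinuousOn (fun t : ℝ => (zMap (hFun b) G (0 + t * ζ)).re) (Ici 0) := by
    simpa only [zero_add, Function.comp_def] using Complex.continuous_re.comp_continuousOn
      (continuousOn_ray (continuousOn_zMap hb0 hc) (rightHalfPlane_subset hζ))
  have hder : ∀ t ∈ interior (Ici (0 : ℝ)), HasDerivAt
      (fun t : ℝ => (zMap (hFun b) G (0 + t * ζ)).re)
      (hSlope b (0 + t * ζ) * ζ - (starRingEnd ℂ) (1 / hSlope b (0 + t * ζ) * ζ)).re t := by
    intro t ht
    rw [interior_Ici] at ht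
    exact Complex.reCLM.hasFDerivAt.comp_hasDerivAt t (hasDerivAt_zMap_line hb0 hG
      (by simpa using ofReal_mul_mem hζ ht))
  have := monotoneOn_of_deriv_nonneg (convex_Ici 0) hcont
    (fun t ht => (hder t ht).differentiableAt.differentiableWithinAt) (fun t ht => ?_)
    (self_mem_Ici (a := (0 : ℝ))) (mem_Ici.2 zero_le_one) zero_le_one
  · simpa using this
  · rw [(hder t ht).deriv]
    rw [interior_Ici] at ht
    have h1 := re_mul_hSlope_sub_pos hb0 hb1 (ofReal_mul_mem hζ ht)
    have ht' : 0 < t := ht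
    have e : hSlope b (t * ζ) * (t * ζ) - (starRingEnd ℂ) (1 / hSlope b (t * ζ) * (t * ζ)) =
        t * (hSlope b (t * ζ) * ζ - (starRingEnd ℂ) (1 / hSlope b (t * ζ) * ζ)) := by
      simp only [map_mul, Complex.conj_ofReal]
      ring
    rw [e, Complex.re_ofReal_mul] at h1
    rw [zero_add]
    exact (pos_of_mul_pos_right h1 ht'.le).le

/-- `F` is real on the positive axis, so `z` moves horizontally there. This locates points of `D`
inside any sector. -/
theorem im_zMap_ofReal {b : ℝ} (hb0 : 0 < b) {G : ℂ → ℂ}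
    (hG : IsAntiderivInv (hFun b) G) {x : ℝ} (hx : 1 ≤ x) :
    (zMap (hFun b) G x).im = (zMap (hFun b) G 1).im := by
  have hder : ∀ t ∈ Ici (1 : ℝ), HasDerivWithinAt
      (fun t : ℝ => (zMap (hFun b) G (0 + t * 1)).im) 0 (Ici 1) t := by
    intro t ht
    have ht0 : (0 : ℝ) < t := zero_lt_one.trans_le ht
    have := Complex.imCLM.hasFDerivAt.comp_hasDerivAt t (hasDerivAt_zMap_line (p := 0) (d := 1)
      hb0 hG (by simpa [rightHalfPlane] using ht0))
    refine (this.congr_deriv ?_).hasDerivWithinAt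
    have e : hSlope b (0 + t * 1) = ((1 + t ^ (b - 1) : ℝ) : ℂ) := by
      simp only [hSlope, zero_add, mul_one]
      rw [show ((b : ℂ) - 1) = ((b - 1 : ℝ) : ℂ) by push_cast; rfl,
        ← Complex.ofReal_cpow ht0.le]
      push_cast
      rfl
    rw [e, mul_one, mul_one, ← Complex.ofReal_one, ← Complex.ofReal_div, Complex.conj_ofReal,
      ← Complex.ofReal_sub, Complex.imCLM_apply, Complex.ofReal_im]
  have := (convex_Ici (1 : ℝ)).norm_image_sub_le_of_norm_hasDerivWithin_le (C := 0) hder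
    (fun _ _ => by simp) self_mem_Ici hx
  simpa [sub_eq_zero] using this

/-! ### Harmonicity, the differential of `z`, and openness of the image -/

theorem analyticAt_of_hasDerivAt {f f' : ℂ → ℂ} (hf : ∀ ζ ∈ rightHalfPlane, HasDerivAt f (f' ζ) ζ)
    {ζ : ℂ} (hζ : ζ ∈ rightHalfPlane) : AnalyticAt ℂ f ζ :=
  DifferentiableOn.analyticAt (s := rightHalfPlane)
    (fun z hz => (hf z hz).differentiableAt.differentiableWithinAt)
    (isOpen_rightHalfPlane.mem_nhds hζ)

theorem harmonicOnNhd_zMap {b : ℝ} (hb0 : 0 < b) {G : ℂ → ℂ}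
    (hG : IsAntiderivInv (hFun b) G) :
    InnerProductSpace.HarmonicOnNhd (zMap (hFun b) G) rightHalfPlane := fun _ hζ =>
  (analyticAt_of_hasDerivAt (fun _ => hasDerivAt_hFun hb0.ne') hζ).harmonicAt.sub
    ((analyticAt_of_hasDerivAt (fun _ => hG.hasDerivAt hb0) hζ).harmonicAt.comp_CLM
      Complex.conjCLE.toContinuousLinearMap)

theorem contDiffAt_zMap {b : ℝ} (hb0 : 0 < b) {G : ℂ → ℂ}
    (hG : IsAntiderivInv (hFun b) G) {ζ : ℂ} (hζ : ζ ∈ rightHalfPlane) :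
    ContDiffAt ℝ 2 (zMap (hFun b) G) ζ := (harmonicOnNhd_zMap hb0 hG ζ hζ).1

/-- The real-linear map `d ↦ F d - conj (d / F)`. -/
noncomputable def slopeMap (F : ℂ) : ℂ →L[ℝ] ℂ :=
  ContinuousLinearMap.mul ℝ ℂ F -
    Complex.conjCLE.toContinuousLinearMap.comp (ContinuousLinearMap.mul ℝ ℂ (1 / F))

theorem slopeMap_apply (F d : ℂ) : slopeMap F d = F * d - (starRingEnd ℂ) (1 / F * d) := rfl

theorem hasFDerivAt_zMap {b : ℝ} (hb0 : 0 < b) {G : ℂ → ℂ}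
    (hG : IsAntiderivInv (hFun b) G) {ζ : ℂ} (hζ : ζ ∈ rightHalfPlane) :
    HasFDerivAt (zMap (hFun b) G) (slopeMap (hSlope b ζ)) ζ := by
  have h1 := (hasDerivAt_hFun hb0.ne' hζ).hasFDerivAt.restrictScalars ℝ
  have h2 := (hG.hasDerivAt hb0 hζ).hasFDerivAt.restrictScalars ℝ
  refine (h1.sub (Complex.conjCLE.toContinuousLinearMap.hasFDerivAt.comp ζ h2)).congr_fderiv ?_
  ext d
  simp [slopeMap_apply, mul_comm]

theorem conj_mul_slopeMap {F : ℂ} (hF : F ≠ 0) (d : ℂ) :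
    (starRingEnd ℂ) F * slopeMap F d = (Complex.normSq F : ℂ) * d - (starRingEnd ℂ) d := by
  have hc : (starRingEnd ℂ) F ≠ 0 := (map_ne_zero _).2 hF
  rw [slopeMap_apply, ← Complex.mul_conj, map_mul, map_div₀, map_one]
  field_simp

theorem one_lt_normSq {F : ℂ} (hF : 1 < ‖F‖) : 1 < Complex.normSq F := by
  rw [← Complex.sq_norm]
  nlinarith

/-- Multiplying by `conj F` gives `|F|² d - conj d = conj F · w`, which decouples: the real part of
`d` gets the factor `|F|² - 1`, the imaginary part `|F|² + 1`. -/
theorem re_im_of_slopeMap {F d w : ℂ} (hF : 1 < ‖F‖) (h : slopeMap F d = w) :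
    d.re = (F.re * w.re + F.im * w.im) / (Complex.normSq F - 1) ∧
      d.im = (F.re * w.im - F.im * w.re) / (Complex.normSq F + 1) := by
  have hF0 : F ≠ 0 := norm_pos_iff.1 (zero_lt_one.trans hF)
  have hN := one_lt_normSq hF
  have e := conj_mul_slopeMap hF0 d
  rw [h] at e
  have e1 := congrArg Complex.re e
  have e2 := congrArg Complex.im e
  simp only [Complex.mul_re, Complex.mul_im, Complex.conj_re, Complex.conj_im, Complex.sub_re,
    Complex.sub_im, Complex.ofReal_re, Complex.ofReal_im] at e1 e2
  constructor
  · rw [eq_div_iff (by linarith)]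
    linarith
  · rw [eq_div_iff (by linarith)]
    linarith

theorem exists_equiv_slopeMap {F : ℂ} (hF : 1 < ‖F‖) :
    ∃ A : ℂ ≃L[ℝ] ℂ, (A : ℂ →L[ℝ] ℂ) = slopeMap F := by
  have hinj : Function.Injective (slopeMap F : ℂ →ₗ[ℝ] ℂ) := by
    refine (injective_iff_map_eq_zero _).2 fun d hd => ?_
    obtain ⟨h1, h2⟩ := re_im_of_slopeMap (w := 0) hF hd
    exact Complex.ext (by simpa using h1) (by simpa using h2)
  exact ⟨(LinearEquiv.ofInjectiveEndo _ hinj).toContinuousLinearEquiv, by ext d; rfl⟩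

theorem exists_equiv_hasFDerivAt_zMap {b : ℝ} (hb0 : 0 < b) (hb1 : b < 1) {G : ℂ → ℂ}
    (hG : IsAntiderivInv (hFun b) G) {ζ : ℂ} (hζ : ζ ∈ rightHalfPlane) :
    ∃ A : ℂ ≃L[ℝ] ℂ, HasFDerivAt (zMap (hFun b) G) (A : ℂ →L[ℝ] ℂ) ζ := by
  obtain ⟨A, hA⟩ := exists_equiv_slopeMap (one_lt_norm_hSlope hb0 hb1 hζ)
  exact ⟨A, hA ▸ hasFDerivAt_zMap hb0 hG hζ⟩

theorem isOpen_image_zMap {b : ℝ} (hb0 : 0 < b) (hb1 : b < 1) {G : ℂ → ℂ}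
    (hG : IsAntiderivInv (hFun b) G) : IsOpen (zMap (hFun b) G '' rightHalfPlane) := by
  rw [isOpen_iff_mem_nhds]
  rintro _ ⟨ζ, hζ, rfl⟩
  obtain ⟨A, hA⟩ := exists_equiv_hasFDerivAt_zMap hb0 hb1 hG hζ
  have := ((contDiffAt_zMap hb0 hG hζ).hasStrictFDerivAt' hA two_ne_zero).map_nhds_eq_of_equiv
  rw [← this]
  exact image_mem_map (isOpen_rightHalfPlane.mem_nhds hζ)

theorem isConnected_image_zMap {b : ℝ} (hb0 : 0 < b) {G : ℂ → ℂ}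
    (hG : IsAntiderivInv (hFun b) G) : IsConnected (zMap (hFun b) G '' rightHalfPlane) :=
  ⟨⟨_, 1, by simp [rightHalfPlane], rfl⟩, convex_rightHalfPlane.isPreconnected.image _
    fun _ hζ => (contDiffAt_zMap hb0 hG hζ).continuousAt.continuousWithinAt⟩

/-! ### The inverse map and the minimal surface equation -/

/-- The inverse of an injective `C²` map is `C²` at images of interior points with invertible
derivative. -/
theorem Set.InjOn.contDiffAt_invFunOn {f : ℂ → ℂ} {S : Set ℂ} (hf : InjOn f S) {a : ℂ}
    (hS : S ∈ 𝓝 a) (hd : ContDiffAt ℝ 2 f a) {A : ℂ ≃L[ℝ] ℂ}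
    (hA : HasFDerivAt f (A : ℂ →L[ℝ] ℂ) a) :
    ContDiffAt ℝ 2 (Function.invFunOn f S) (f a) := by
  have hg := hd.to_localInverse hA two_ne_zero
  refine hg.congr_of_eventuallyEq ?_
  have h1 := (hd.hasStrictFDerivAt' hA two_ne_zero).eventually_right_inverse
  have h2 : Tendsto (hd.localInverse hA two_ne_zero) (𝓝 (f a)) (𝓝 a) := by
    have := hg.continuousAt.tendsto
    rwa [hd.localInverse_apply_image hA two_ne_zero] at this
  -- Near `f a` the local inverse takes values in `S`, where injectivity forces it to equal the
  -- global one.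
  filter_upwards [h1, h2 hS] with y hy hyS
  have hy' : f (hd.localInverse hA two_ne_zero y) = y := hy
  conv_lhs => rw [← hy']
  exact hf.leftInvOn_invFunOn hyS

/-- The inverse of `zMap (hFun b) G` on the closed right half-plane. -/
noncomputable def zInv (b : ℝ) (G : ℂ → ℂ) : ℂ → ℂ :=
  Function.invFunOn (zMap (hFun b) G) closedRightHalfPlane

theorem zInv_zMap {b : ℝ} (hb0 : 0 < b) (hb1 : b < 1) {G : ℂ → ℂ}
    (hG : IsAntiderivInv (hFun b) G) (hc : Continuous G) {ζ : ℂ}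
    (hζ : ζ ∈ closedRightHalfPlane) : zInv b G (zMap (hFun b) G ζ) = ζ :=
  (injOn_zMap_closed hb0 hb1 hG hc).leftInvOn_invFunOn hζ

theorem contDiffAt_zInv {b : ℝ} (hb0 : 0 < b) (hb1 : b < 1) {G : ℂ → ℂ}
    (hG : IsAntiderivInv (hFun b) G) (hc : Continuous G) {w : ℂ}
    (hw : w ∈ zMap (hFun b) G '' rightHalfPlane) : ContDiffAt ℝ 2 (zInv b G) w := by
  obtain ⟨ζ, hζ, rfl⟩ := hw
  obtain ⟨A, hA⟩ := exists_equiv_hasFDerivAt_zMap hb0 hb1 hG hζ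
  exact (injOn_zMap_closed hb0 hb1 hG hc).contDiffAt_invFunOn
    (mem_of_superset (isOpen_rightHalfPlane.mem_nhds hζ) rightHalfPlane_subset)
    (contDiffAt_zMap hb0 hG hζ) hA

theorem slopeMap_fderiv_zInv {b : ℝ} (hb0 : 0 < b) (hb1 : b < 1) {G : ℂ → ℂ}
    (hG : IsAntiderivInv (hFun b) G) (hc : Continuous G) {w : ℂ}
    (hw : w ∈ zMap (hFun b) G '' rightHalfPlane) (d : ℂ) :
    slopeMap (hSlope b (zInv b G w)) (fderiv ℝ (zInv b G) w d) = d := by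
  have hD := (isOpen_image_zMap hb0 hb1 hG).mem_nhds hw
  have h1 := ((contDiffAt_zInv hb0 hb1 hG hc hw).differentiableAt two_ne_zero).hasFDerivAt
  obtain ⟨ζ, hζ, hζw⟩ := id hw
  have hz : zInv b G w = ζ := hζw ▸ zInv_zMap hb0 hb1 hG hc (rightHalfPlane_subset hζ)
  have h2 := hasFDerivAt_zMap hb0 hG (hz.symm ▸ hζ)
  have h3 := h2.comp w h1
  have h4 : (zMap (hFun b) G ∘ zInv b G) =ᶠ[𝓝 w] id := by
    filter_upwards [hD] with y hy
    obtain ⟨η, hη, rfl⟩ := hy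
    simp only [Function.comp, id, zInv_zMap hb0 hb1 hG hc (rightHalfPlane_subset hη)]
  have h5 := h3.unique ((hasFDerivAt_id w).congr_of_eventuallyEq h4)
  exact DFunLike.congr_fun h5 d

theorem zInv_mem {b : ℝ} (hb0 : 0 < b) (hb1 : b < 1) {G : ℂ → ℂ}
    (hG : IsAntiderivInv (hFun b) G) (hc : Continuous G) {w : ℂ}
    (hw : w ∈ zMap (hFun b) G '' rightHalfPlane) : zInv b G w ∈ rightHalfPlane := by
  obtain ⟨ζ, hζ, rfl⟩ := hw
  rwa [zInv_zMap hb0 hb1 hG hc (rightHalfPlane_subset hζ)]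

/-- The height function `u = 2 Re ζ` over the image of `zMap`. -/
noncomputable def heightFun (b : ℝ) (G : ℂ → ℂ) (w : ℂ) : ℝ := 2 * (zInv b G w).re

/-- The function `2 Im ζ`, whose rotated gradient is `∇u / √(1 + |∇u|²)`. -/
noncomputable def conjugateFun (b : ℝ) (G : ℂ → ℂ) (w : ℂ) : ℝ := 2 * (zInv b G w).im

theorem contDiffAt_heightFun {b : ℝ} (hb0 : 0 < b) (hb1 : b < 1) {G : ℂ → ℂ}
    (hG : IsAntiderivInv (hFun b) G) (hc : Continuous G) {w : ℂ}
    (hw : w ∈ zMap (hFun b) G '' rightHalfPlane) : ContDiffAt ℝ 2 (heightFun b G) w :=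
  contDiffAt_const.mul
    (Complex.reCLM.contDiff.contDiffAt.comp w (contDiffAt_zInv hb0 hb1 hG hc hw))

theorem contDiffAt_conjugateFun {b : ℝ} (hb0 : 0 < b) (hb1 : b < 1) {G : ℂ → ℂ}
    (hG : IsAntiderivInv (hFun b) G) (hc : Continuous G) {w : ℂ}
    (hw : w ∈ zMap (hFun b) G '' rightHalfPlane) : ContDiffAt ℝ 2 (conjugateFun b G) w :=
  contDiffAt_const.mul
    (Complex.imCLM.contDiff.contDiffAt.comp w (contDiffAt_zInv hb0 hb1 hG hc hw))

/-- With `N = |F|²`, inverting `dz` gives `∇u = 2F/(N-1)` as a complex number, so `1 + |∇u|² =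
((N+1)/(N-1))²`. The quotient `2F/(N+1)` is `∇(2 Im ζ)` turned by a right angle. -/
theorem partial_div_areaDensity_heightFun {b : ℝ} (hb0 : 0 < b) (hb1 : b < 1) {G : ℂ → ℂ}
    (hG : IsAntiderivInv (hFun b) G) (hc : Continuous G) {w : ℂ}
    (hw : w ∈ zMap (hFun b) G '' rightHalfPlane) :
    partialX (heightFun b G) w / areaDensity (heightFun b G) w = partialY (conjugateFun b G) w ∧
    partialY (heightFun b G) w / areaDensity (heightFun b G) w =
      -partialX (conjugateFun b G) w := by
  have hdiff := ((contDiffAt_zInv hb0 hb1 hG hc hw).differentiableAt two_ne_zero).hasFDerivAt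
  have hu := (Complex.reCLM.hasFDerivAt.comp w hdiff).const_mul 2
  have hv := (Complex.imCLM.hasFDerivAt.comp w hdiff).const_mul 2
  have hu' : fderiv ℝ (heightFun b G) w = _ := hu.fderiv
  have hv' : fderiv ℝ (conjugateFun b G) w = _ := hv.fderiv
  have hF := one_lt_norm_hSlope hb0 hb1 (zInv_mem hb0 hb1 hG hc hw)
  have hN := one_lt_normSq hF
  obtain ⟨x1, x2⟩ := re_im_of_slopeMap hF (slopeMap_fderiv_zInv hb0 hb1 hG hc hw 1)
  obtain ⟨y1, y2⟩ := re_im_of_slopeMap hF (slopeMap_fderiv_zInv hb0 hb1 hG hc hw Complex.I)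
  set F := hSlope b (zInv b G w)
  set N := Complex.normSq F with hNdef
  have hNe : N = F.re ^ 2 + F.im ^ 2 := by rw [hNdef, Complex.normSq_apply]; ring
  have ux : partialX (heightFun b G) w = 2 * F.re / (N - 1) := by
    simp [partialX, hu', x1]; ring
  have uy : partialY (heightFun b G) w = 2 * F.im / (N - 1) := by
    simp [partialY, hu', y1]; ring
  have vx : partialX (conjugateFun b G) w = -(2 * F.im / (N + 1)) := by
    simp [partialX, hv', x2]; ring
  have vy : partialY (conjugateFun b G) w = 2 * F.re / (N + 1) := by
    simp [partialY, hv', y2]; ring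
  have hm : 0 < N - 1 := by linarith
  have hp : 0 < N + 1 := by linarith
  have hW : areaDensity (heightFun b G) w = (N + 1) / (N - 1) := by
    rw [areaDensity, ux, uy, ← Real.sqrt_sq (div_pos hp hm).le]
    congr 1
    field_simp
    rw [hNe]
    ring
  rw [hW, ux, uy, vx, vy]
  constructor <;> field_simp

/-- A rotated gradient has zero divergence by symmetry of second derivatives. -/
theorem minimalSurfaceOperator_heightFun {b : ℝ} (hb0 : 0 < b) (hb1 : b < 1) {G : ℂ → ℂ}
    (hG : IsAntiderivInv (hFun b) G) (hc : Continuous G) {w : ℂ}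
    (hw : w ∈ zMap (hFun b) G '' rightHalfPlane) :
    minimalSurfaceOperator (heightFun b G) w = 0 := by
  have hD := (isOpen_image_zMap hb0 hb1 hG).mem_nhds hw
  have hv := contDiffAt_conjugateFun hb0 hb1 hG hc hw
  have e1 : (fun v => partialX (heightFun b G) v / areaDensity (heightFun b G) v) =ᶠ[𝓝 w]
      fun v => fderiv ℝ (conjugateFun b G) v Complex.I := by
    filter_upwards [hD] with y hy
    exact (partial_div_areaDensity_heightFun hb0 hb1 hG hc hy).1
  have e2 : (fun v => partialY (heightFun b G) v / areaDensity (heightFun b G) v) =ᶠ[𝓝 w]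
      fun v => -fderiv ℝ (conjugateFun b G) v 1 := by
    filter_upwards [hD] with y hy
    exact (partial_div_areaDensity_heightFun hb0 hb1 hG hc hy).2
  have hdd : DifferentiableAt ℝ (fderiv ℝ (conjugateFun b G)) w :=
    (hv.fderiv_right (m := 1) (by norm_num)).differentiableAt one_ne_zero
  have hsymm := hv.isSymmSndFDerivAt (by simp) 1 Complex.I
  rw [minimalSurfaceOperator, partialX, partialY, e1.fderiv_eq, e2.fderiv_eq, fderiv_fun_neg,
    fderiv_clm_apply hdd (differentiableAt_const _), fderiv_clm_apply hdd (differentiableAt_const _)]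
  simp [hsymm]

/-! ### Properness and boundary values -/

theorem norm_le_of_norm_zMap_sub_le {b : ℝ} (hb0 : 0 < b) (hb1 : b < 1) {G : ℂ → ℂ}
    (hG : IsAntiderivInv (hFun b) G) (hc : Continuous G) {ζ : ℂ}
    (hζ : ζ ∈ closedRightHalfPlane) {S : ℝ}
    (hS : ‖zMap (hFun b) G ζ - zMap (hFun b) G 0‖ ≤ S) : ‖ζ‖ ≤ (S / angleConst b) ^ b⁻¹ := by
  have hκ := angleConst_pos hb0 hb1
  have h1 := (mul_rpow_norm_le_norm_zMap_sub hb0 hb1 hG hc hζ).trans hS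
  have h2 : ‖ζ‖ ^ b ≤ S / angleConst b := by
    rw [le_div_iff₀ hκ]
    linarith
  exact (Real.le_rpow_inv_iff_of_pos (norm_nonneg _)
    ((Real.rpow_nonneg (norm_nonneg _) _).trans h2) hb0).2 h2

theorem exists_norm_le_of_dist_zMap_lt {b : ℝ} (hb0 : 0 < b) (hb1 : b < 1) {G : ℂ → ℂ}
    (hG : IsAntiderivInv (hFun b) G) (hc : Continuous G) (w : ℂ) :
    ∃ R : ℝ, 0 < R ∧ ∀ ζ ∈ closedRightHalfPlane, zMap (hFun b) G ζ ∈ Metric.ball w 1 → ‖ζ‖ ≤ R := by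
  refine ⟨max ((((1 + ‖w - zMap (hFun b) G 0‖)) / angleConst b) ^ b⁻¹) 1,
    zero_lt_one.trans_le (le_max_right _ _), fun ζ hζ h => le_max_of_le_left ?_⟩
  refine norm_le_of_norm_zMap_sub_le hb0 hb1 hG hc hζ ?_
  rw [mem_ball_iff_norm] at h
  have := norm_add_le (zMap (hFun b) G ζ - w) (w - zMap (hFun b) G 0)
  rw [sub_add_sub_cancel] at this
  linarith

/-- By properness, near any `w` only a compact piece of the half-plane contributes to the image. -/
theorem isClosed_image_zMap {b : ℝ} (hb0 : 0 < b) (hb1 : b < 1) {G : ℂ → ℂ}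
    (hG : IsAntiderivInv (hFun b) G) (hc : Continuous G) :
    IsClosed (zMap (hFun b) G '' closedRightHalfPlane) := by
  refine isClosed_of_closure_subset fun w hw => ?_
  obtain ⟨R, -, hR⟩ := exists_norm_le_of_dist_zMap_lt hb0 hb1 hG hc w
  have hK : IsCompact (zMap (hFun b) G '' (Metric.closedBall 0 R ∩ closedRightHalfPlane)) :=
    ((isCompact_closedBall 0 R).inter_right isClosed_closedRightHalfPlane).image_of_continuousOn
      ((continuousOn_zMap hb0 hc).mono inter_subset_right)
  have hsub : Metric.ball w 1 ∩ zMap (hFun b) G '' closedRightHalfPlane ⊆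
      zMap (hFun b) G '' (Metric.closedBall 0 R ∩ closedRightHalfPlane) := by
    rintro _ ⟨h, ζ, hζ, rfl⟩
    exact ⟨ζ, ⟨by simpa using hR ζ hζ h, hζ⟩, rfl⟩
  have h1 := Metric.isOpen_ball.inter_closure ⟨Metric.mem_ball_self zero_lt_one, hw⟩
  exact image_mono inter_subset_right (closure_minimal hsub hK.isClosed h1)

theorem closure_image_zMap_subset {b : ℝ} (hb0 : 0 < b) (hb1 : b < 1) {G : ℂ → ℂ}
    (hG : IsAntiderivInv (hFun b) G) (hc : Continuous G) :
    closure (zMap (hFun b) G '' rightHalfPlane) ⊆ zMap (hFun b) G '' closedRightHalfPlane :=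
  closure_minimal (image_mono rightHalfPlane_subset) (isClosed_image_zMap hb0 hb1 hG hc)

/-- Preimages of a unit ball lie in a fixed disc, on which the injectivity estimate is a Lipschitz
bound for the inverse. -/
theorem continuousOn_zInv {b : ℝ} (hb0 : 0 < b) (hb1 : b < 1) {G : ℂ → ℂ}
    (hG : IsAntiderivInv (hFun b) G) (hc : Continuous G) :
    ContinuousOn (zInv b G) (zMap (hFun b) G '' closedRightHalfPlane) := by
  rintro _ ⟨p, hp, rfl⟩
  set w := zMap (hFun b) G p with hw
  obtain ⟨R, hR0, hR⟩ := exists_norm_le_of_dist_zMap_lt hb0 hb1 hG hc w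
  have hpos := mul_pos (angleConst_pos hb0 hb1) (Real.rpow_pos_of_pos hR0 (b - 1))
  refine tendsto_iff_norm_sub_tendsto_zero.2 ?_
  have hlim : Tendsto (fun y : ℂ => ‖y - w‖ / (angleConst b * R ^ (b - 1)))
      (𝓝[zMap (hFun b) G '' closedRightHalfPlane] w) (𝓝 0) := by
    have : Continuous (fun y : ℂ => ‖y - w‖ / (angleConst b * R ^ (b - 1))) := by fun_prop
    simpa using (this.tendsto w).mono_left nhdsWithin_le_nhds
  refine squeeze_zero' (Eventually.of_forall fun _ => norm_nonneg _) ?_ hlim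
  filter_upwards [self_mem_nhdsWithin,
    mem_nhdsWithin_of_mem_nhds (Metric.ball_mem_nhds w zero_lt_one)] with y hy hyb
  obtain ⟨q, hq, rfl⟩ := hy
  rw [hw, zInv_zMap hb0 hb1 hG hc hp, zInv_zMap hb0 hb1 hG hc hq, le_div_iff₀ hpos, mul_comm]
  exact mul_norm_sub_le_norm_zMap_sub_of_closed hb0 hb1 hG hc hR0 hp hq
    (hR p hp (Metric.mem_ball_self zero_lt_one)) (hR q hq hyb)

theorem continuousOn_heightFun {b : ℝ} (hb0 : 0 < b) (hb1 : b < 1) {G : ℂ → ℂ}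
    (hG : IsAntiderivInv (hFun b) G) (hc : Continuous G) :
    ContinuousOn (heightFun b G) (closure (zMap (hFun b) G '' rightHalfPlane)) :=
  continuousOn_const.mul (Complex.continuous_re.comp_continuousOn
    ((continuousOn_zInv hb0 hb1 hG hc).mono (closure_image_zMap_subset hb0 hb1 hG hc)))

theorem heightFun_zMap {b : ℝ} (hb0 : 0 < b) (hb1 : b < 1) {G : ℂ → ℂ}
    (hG : IsAntiderivInv (hFun b) G) (hc : Continuous G) {ζ : ℂ}
    (hζ : ζ ∈ rightHalfPlane) : heightFun b G (zMap (hFun b) G ζ) = 2 * ζ.re := by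
  rw [heightFun, zInv_zMap hb0 hb1 hG hc (rightHalfPlane_subset hζ)]

theorem heightFun_pos {b : ℝ} (hb0 : 0 < b) (hb1 : b < 1) {G : ℂ → ℂ}
    (hG : IsAntiderivInv (hFun b) G) (hc : Continuous G) {w : ℂ}
    (hw : w ∈ zMap (hFun b) G '' rightHalfPlane) : 0 < heightFun b G w :=
  mul_pos two_pos (zInv_mem hb0 hb1 hG hc hw)

theorem exists_of_mem_frontier {b : ℝ} (hb0 : 0 < b) (hb1 : b < 1) {G : ℂ → ℂ}
    (hG : IsAntiderivInv (hFun b) G) (hc : Continuous G) {w : ℂ}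
    (hw : w ∈ frontier (zMap (hFun b) G '' rightHalfPlane)) :
    ∃ ζ : ℂ, ζ.re = 0 ∧ zMap (hFun b) G ζ = w := by
  rw [(isOpen_image_zMap hb0 hb1 hG).frontier_eq] at hw
  obtain ⟨ζ, hζ, rfl⟩ := closure_image_zMap_subset hb0 hb1 hG hc hw.1
  refine ⟨ζ, le_antisymm (not_lt.1 fun h => hw.2 ⟨ζ, h, rfl⟩) hζ, rfl⟩

theorem heightFun_of_mem_frontier {b : ℝ} (hb0 : 0 < b) (hb1 : b < 1) {G : ℂ → ℂ}
    (hG : IsAntiderivInv (hFun b) G) (hc : Continuous G) {w : ℂ}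
    (hw : w ∈ frontier (zMap (hFun b) G '' rightHalfPlane)) : heightFun b G w = 0 := by
  obtain ⟨ζ, hζ, rfl⟩ := exists_of_mem_frontier hb0 hb1 hG hc hw
  rw [heightFun, zInv_zMap hb0 hb1 hG hc hζ.ge, hζ, mul_zero]

theorem ofReal_mem_rightHalfPlane {x : ℝ} (hx : 0 < x) : (x : ℂ) ∈ rightHalfPlane := by
  simpa [rightHalfPlane] using hx

theorem tendsto_norm_zMap_ofReal {b : ℝ} (hb0 : 0 < b) (hb1 : b < 1) {G : ℂ → ℂ}
    (hG : IsAntiderivInv (hFun b) G) (hc : Continuous G) :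
    Tendsto (fun x : ℝ => ‖zMap (hFun b) G x‖) atTop atTop := by
  have h1 : Tendsto (fun x : ℝ => angleConst b * x ^ b - ‖zMap (hFun b) G 0‖) atTop atTop :=
    tendsto_atTop_add_const_right _ _
      ((tendsto_rpow_atTop hb0).const_mul_atTop (angleConst_pos hb0 hb1))
  refine tendsto_atTop_mono' _ ?_ h1
  filter_upwards [eventually_gt_atTop 0] with x hx
  have h2 := mul_rpow_norm_le_norm_zMap_sub hb0 hb1 hG hc
    (rightHalfPlane_subset (ofReal_mem_rightHalfPlane hx))
  rw [Complex.norm_real, Real.norm_of_nonneg hx.le] at h2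
  have := norm_sub_le (zMap (hFun b) G x) (zMap (hFun b) G 0)
  linarith

theorem isPositiveMinimalGraph_heightFun {b : ℝ} (hb0 : 0 < b) (hb1 : b < 1) {G : ℂ → ℂ}
    (hG : IsAntiderivInv (hFun b) G) (hc : Continuous G) :
    IsPositiveMinimalGraph (zMap (hFun b) G '' rightHalfPlane) (heightFun b G) where
  isOpen := isOpen_image_zMap hb0 hb1 hG
  isConnected := isConnected_image_zMap hb0 hG
  unbounded := by
    intro h
    obtain ⟨C, hC⟩ := h.exists_norm_le
    obtain ⟨x, hx0, hx⟩ := ((eventually_gt_atTop 0).and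
      ((tendsto_norm_zMap_ofReal hb0 hb1 hG hc).eventually_gt_atTop C)).exists
    exact (hC _ ⟨x, ofReal_mem_rightHalfPlane hx0, rfl⟩).not_gt hx
  contDiffOn := fun _ hw => (contDiffAt_heightFun hb0 hb1 hG hc hw).contDiffWithinAt
  continuousOn_closure := continuousOn_heightFun hb0 hb1 hG hc
  equation := fun _ => minimalSurfaceOperator_heightFun hb0 hb1 hG hc
  pos := fun _ => heightFun_pos hb0 hb1 hG hc
  boundary := fun _ => heightFun_of_mem_frontier hb0 hb1 hG hc

/-! ### Maxima on circles and the order of growth -/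

/-- The maximum over the compact set `closure D ∩ {|w| = r}` is positive, so it is not attained on
the frontier, where `u = 0`. -/
theorem IsPositiveMinimalGraph.isGreatest_maxOnCircle {D : Set ℂ} {u : ℂ → ℝ}
    (h : IsPositiveMinimalGraph D u) {r : ℝ} (hr : (D ∩ Metric.sphere 0 r).Nonempty) :
    IsGreatest (u '' (D ∩ Metric.sphere 0 r)) (maxOnCircle D u r) := by
  have hK : IsCompact (closure D ∩ Metric.sphere 0 r) :=
    (isCompact_sphere 0 r).inter_left isClosed_closure
  obtain ⟨w₁, hw₁⟩ := hr
  obtain ⟨w₀, hw₀, hmax⟩ := hK.exists_isMaxOn ⟨w₁, subset_closure hw₁.1, hw₁.2⟩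
    (h.continuousOn_closure.mono inter_subset_left)
  have hpos : 0 < u w₀ := (h.pos _ hw₁.1).trans_le (hmax ⟨subset_closure hw₁.1, hw₁.2⟩)
  have hD : w₀ ∈ D := by
    by_contra hn
    have : w₀ ∈ frontier D := by
      rw [h.isOpen.frontier_eq]
      exact ⟨hw₀.1, hn⟩
    exact hpos.ne' (h.boundary _ this)
  have hg : IsGreatest (u '' (D ∩ Metric.sphere 0 r)) (u w₀) := by
    refine ⟨⟨w₀, ⟨hD, hw₀.2⟩, rfl⟩, ?_⟩
    rintro _ ⟨w, hw, rfl⟩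
    exact hmax ⟨subset_closure hw.1, hw.2⟩
  rwa [maxOnCircle, hg.csSup_eq]

theorem eventually_exists_norm_zMap_eq {b : ℝ} (hb0 : 0 < b) (hb1 : b < 1) {G : ℂ → ℂ}
    (hG : IsAntiderivInv (hFun b) G) (hc : Continuous G) :
    ∀ᶠ r : ℝ in atTop, ∃ x : ℝ, 0 < x ∧ ‖zMap (hFun b) G x‖ = r := by
  filter_upwards [eventually_ge_atTop ‖zMap (hFun b) G (1 : ℝ)‖] with r hr
  obtain ⟨x₁, hx₁, hxr⟩ := ((eventually_ge_atTop 1).and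
    ((tendsto_norm_zMap_ofReal hb0 hb1 hG hc).eventually_ge_atTop r)).exists
  have hcont : ContinuousOn (fun x : ℝ => ‖zMap (hFun b) G x‖) (Icc 1 x₁) := by
    refine ((continuousOn_zMap hb0 hc).comp Complex.continuous_ofReal.continuousOn
      fun x hx => ?_).norm
    exact rightHalfPlane_subset (ofReal_mem_rightHalfPlane (zero_lt_one.trans_le hx.1))
  obtain ⟨x, hx, hxe⟩ := intermediate_value_Icc hx₁ hcont ⟨hr, hxr⟩
  exact ⟨x, zero_lt_one.trans_le hx.1, hxe⟩

theorem eventually_nonempty_inter_sphere {b : ℝ} (hb0 : 0 < b) (hb1 : b < 1) {G : ℂ → ℂ}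
    (hG : IsAntiderivInv (hFun b) G) (hc : Continuous G) :
    ∀ᶠ r : ℝ in atTop, (zMap (hFun b) G '' rightHalfPlane ∩ Metric.sphere 0 r).Nonempty := by
  filter_upwards [eventually_exists_norm_zMap_eq hb0 hb1 hG hc] with r ⟨x, hx, hxr⟩
  exact ⟨_, ⟨x, ofReal_mem_rightHalfPlane hx, rfl⟩, by simpa using hxr⟩

theorem eventually_isGreatest_heightFun {b : ℝ} (hb0 : 0 < b) (hb1 : b < 1) {G : ℂ → ℂ}
    (hG : IsAntiderivInv (hFun b) G) (hc : Continuous G) :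
    ∀ᶠ r : ℝ in atTop, IsGreatest
      (heightFun b G '' (zMap (hFun b) G '' rightHalfPlane ∩ Metric.sphere 0 r))
      (maxOnCircle (zMap (hFun b) G '' rightHalfPlane) (heightFun b G) r) :=
  (eventually_nonempty_inter_sphere hb0 hb1 hG hc).mono fun _ =>
    (isPositiveMinimalGraph_heightFun hb0 hb1 hG hc).isGreatest_maxOnCircle

theorem eventually_maxOnCircle_le {b : ℝ} (hb0 : 0 < b) (hb1 : b < 1) {G : ℂ → ℂ}
    (hG : IsAntiderivInv (hFun b) G) (hc : Continuous G) :
    ∀ᶠ r : ℝ in atTop, maxOnCircle (zMap (hFun b) G '' rightHalfPlane) (heightFun b G) r ≤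
      2 * (2 / angleConst b) ^ b⁻¹ * r ^ b⁻¹ := by
  filter_upwards [eventually_isGreatest_heightFun hb0 hb1 hG hc,
    eventually_ge_atTop ‖zMap (hFun b) G 0‖] with r hr hr0
  obtain ⟨_, ⟨⟨ζ, hζ, rfl⟩, hζr⟩, he⟩ := hr.1
  rw [← he, heightFun_zMap hb0 hb1 hG hc hζ]
  have hr' : 0 ≤ r := (norm_nonneg _).trans hr0
  have hS : ‖zMap (hFun b) G ζ - zMap (hFun b) G 0‖ ≤ 2 * r := by
    refine (norm_sub_le _ _).trans ?_
    rw [mem_sphere_zero_iff_norm] at hζr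
    linarith
  have h1 := norm_le_of_norm_zMap_sub_le hb0 hb1 hG hc (rightHalfPlane_subset hζ) hS
  rw [mul_div_right_comm, Real.mul_rpow (by have := angleConst_pos hb0 hb1; positivity) hr'] at h1
  have h2 := Complex.re_le_norm ζ
  linarith

/-- The test point is `z(x)` with `x > 0` and `|z(x)| = r`. The term `2i Im ζ` vanishes there, so
`r/2 ≤ |z(x) - z(0)| ≤ (2/b) x^b`, whence the constant `b/4`. -/
theorem eventually_le_maxOnCircle {b : ℝ} (hb0 : 0 < b) (hb1 : b < 1) {G : ℂ → ℂ}
    (hG : IsAntiderivInv (hFun b) G) (hc : Continuous G) :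
    ∀ᶠ r : ℝ in atTop, 2 * (b / 4) ^ b⁻¹ * r ^ b⁻¹ ≤
      maxOnCircle (zMap (hFun b) G '' rightHalfPlane) (heightFun b G) r := by
  filter_upwards [eventually_isGreatest_heightFun hb0 hb1 hG hc,
    eventually_exists_norm_zMap_eq hb0 hb1 hG hc, eventually_ge_atTop 0,
    eventually_ge_atTop (2 * ‖zMap (hFun b) G 0‖)] with r hr ⟨x, hx, hxr⟩ hr0 hrA
  have hxH := ofReal_mem_rightHalfPlane hx
  have h1 := hr.2 ⟨_, ⟨⟨x, hxH, rfl⟩, by simpa using hxr⟩, rfl⟩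
  rw [heightFun_zMap hb0 hb1 hG hc hxH, Complex.ofReal_re] at h1
  have h2 := norm_zMap_sub_le hb0 hb1 hG hc (rightHalfPlane_subset hxH)
  rw [Complex.ofReal_im, Complex.norm_real, Real.norm_of_nonneg hx.le] at h2
  simp only [Complex.ofReal_zero, mul_zero, zero_mul, sub_zero] at h2
  have h3 := norm_sub_norm_le (zMap (hFun b) G x) (zMap (hFun b) G 0)
  have h4 : b / 4 * r ≤ x ^ b := by
    have : r / 2 ≤ 2 / b * x ^ b := by linarith
    have h5 := mul_le_mul_of_nonneg_left this hb0.le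
    field_simp at h5 ⊢
    linarith
  have h6 := (Real.rpow_inv_le_iff_of_pos (by positivity) hx.le hb0).2 h4
  rw [Real.mul_rpow (by positivity) hr0] at h6
  linarith

theorem limsup_log_div_log_eq {M : ℝ → ℝ} {p C₁ C₂ : ℝ} (hC₁ : 0 < C₁)
    (hC₂ : 0 < C₂) (h₁ : ∀ᶠ r in atTop, C₁ * r ^ p ≤ M r) (h₂ : ∀ᶠ r in atTop, M r ≤ C₂ * r ^ p) :
    limsup (fun r : ℝ => ((Real.log (M r) / Real.log r : ℝ) : EReal)) atTop = (p : EReal) := by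
  have hlim : ∀ C : ℝ, Tendsto (fun r : ℝ => Real.log C / Real.log r + p) atTop (𝓝 p) := by
    intro C
    simpa using (Real.tendsto_log_atTop.const_div_atTop (Real.log C)).add_const p
  have hlog : ∀ {C r : ℝ}, 0 < C → 1 < r →
      Real.log (C * r ^ p) / Real.log r = Real.log C / Real.log r + p := by
    intro C r hC hr
    have hr0 : 0 < r := zero_lt_one.trans hr
    rw [Real.log_mul hC.ne' (Real.rpow_pos_of_pos hr0 p).ne', Real.log_rpow hr0, add_div,
      mul_div_cancel_right₀ _ (Real.log_pos hr).ne']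
  have ht : Tendsto (fun r : ℝ => Real.log (M r) / Real.log r) atTop (𝓝 p) := by
    refine tendsto_of_tendsto_of_tendsto_of_le_of_le' (hlim C₁) (hlim C₂) ?_ ?_
    · filter_upwards [h₁, eventually_gt_atTop 1] with r hr hr1
      have hr0 : 0 < r := zero_lt_one.trans hr1
      rw [← hlog hC₁ hr1]
      have := Real.log_pos hr1
      gcongr
    · filter_upwards [h₁, h₂, eventually_gt_atTop 1] with r hr hr' hr1
      have hr0 : 0 < r := zero_lt_one.trans hr1
      rw [← hlog hC₂ hr1]
      have := Real.log_pos hr1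
      have hM : 0 < M r := lt_of_lt_of_le (by positivity) hr
      gcongr
  exact ((continuous_coe_real_ereal.tendsto p).comp ht).limsup_eq

theorem growthOrder_heightFun {b : ℝ} (hb0 : 0 < b) (hb1 : b < 1) {G : ℂ → ℂ}
    (hG : IsAntiderivInv (hFun b) G) (hc : Continuous G) :
    growthOrder (zMap (hFun b) G '' rightHalfPlane) (heightFun b G) = ((b⁻¹ : ℝ) : EReal) := by
  have := angleConst_pos hb0 hb1
  exact limsup_log_div_log_eq (by positivity) (by positivity)
    (eventually_le_maxOnCircle hb0 hb1 hG hc) (eventually_maxOnCircle_le hb0 hb1 hG hc)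

/-! ### The asymptotic angle -/

/-- The image of the right half-plane contains the far part of every sector around the positive
real axis of opening less than `π`. -/
theorem exists_sector_subset_image_zMap {b : ℝ} (hb0 : 0 < b) (hb1 : b < 1) {G : ℂ → ℂ}
    (hG : IsAntiderivInv (hFun b) G) (hc : Continuous G) {k : ℝ} (hk : 0 < k) :
    ∃ R : ℝ, ∀ w : ℂ, R < w.re → |w.im| ≤ k * w.re →
      w ∈ zMap (hFun b) G '' rightHalfPlane := by
  set A := ‖zMap (hFun b) G 0‖ with hA
  -- Since `b < 1`, the error `y^b` is negligible against `2y`; beyond `Y` this keeps the boundary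
  -- points `z(±iy)` out of the sector.
  have hlin : ∀ᶠ y : ℝ in atTop, (1 + k) * (A + 2 / b * y ^ b) < 2 * y := by
    have h1 : Tendsto (fun y : ℝ => (1 + k) * (A * y⁻¹ + 2 / b * y ^ (-(1 - b)))) atTop
        (𝓝 ((1 + k) * (A * 0 + 2 / b * 0))) :=
      ((tendsto_inv_atTop_zero.const_mul A).add
        ((tendsto_rpow_neg_atTop (sub_pos.2 hb1)).const_mul _)).const_mul _
    filter_upwards [h1.eventually_lt_const (show _ < (2 : ℝ) by simp), eventually_gt_atTop 0]
      with y hy hy0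
    have h2 := mul_lt_mul_of_pos_right hy hy0
    have h3 : y ^ (-(1 - b)) * y = y ^ b := by
      rw [← Real.rpow_add_one hy0.ne']
      congr 1
      ring
    have h4 : y⁻¹ * y = 1 := inv_mul_cancel₀ hy0.ne'
    calc (1 + k) * (A + 2 / b * y ^ b)
        = (1 + k) * (A * (y⁻¹ * y) + 2 / b * (y ^ (-(1 - b)) * y)) := by rw [h3, h4, mul_one]
      _ < 2 * y := by linarith
  obtain ⟨Y, hY⟩ := eventually_atTop.1 hlin
  set R := max 0 (A + 2 / b * (max Y 0) ^ b) with hRdef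
  refine ⟨R, fun w hw1 hw2 => ?_⟩
  let K : Set ℂ := {w | R < w.re ∧ |w.im| ≤ k * w.re}
  have hKc : Convex ℝ K := by
    have : K = {w : ℂ | R < Complex.reLm w} ∩ ({w | (Complex.imLm - k • Complex.reLm) w ≤ 0} ∩
        {w | 0 ≤ (Complex.imLm + k • Complex.reLm) w}) := by
      ext w
      simp only [K, mem_ofPred_eq, mem_inter_iff, abs_le, LinearMap.sub_apply, LinearMap.add_apply,
        LinearMap.smul_apply, smul_eq_mul, Complex.reLm_coe, Complex.imLm_coe]
      refine and_congr_right fun _ => ⟨fun h => ⟨?_, ?_⟩, fun h => ⟨?_, ?_⟩⟩ <;> linarith [h.1, h.2]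
    rw [this]
    exact (convex_halfSpace_gt (LinearMap.isLinear _) _).inter
      ((convex_halfSpace_le (LinearMap.isLinear _) _).inter
        (convex_halfSpace_ge (LinearMap.isLinear _) _))
  -- The truncated sector `K` is connected, so it lies in the open set `D` once it meets `D` and
  -- contains no frontier point of `D`.
  refine hKc.isPreconnected.subset_of_closure_inter_subset (isOpen_image_zMap hb0 hb1 hG) ?_ ?_
    (show w ∈ K from ⟨hw1, hw2⟩)
  -- `K` meets `D`: along the real axis `|z|` tends to infinity while `Im z` is constant and `Re z`
  -- is bounded below.
  · have him : ∀ x : ℝ, 1 ≤ x → |(zMap (hFun b) G x).im| = |(zMap (hFun b) G 1).im| :=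
      fun x hx => by rw [im_zMap_ofReal hb0 hG hx]
    obtain ⟨x, hx1, hx⟩ := ((eventually_ge_atTop 1).and
      ((tendsto_norm_zMap_ofReal hb0 hb1 hG hc).eventually_gt_atTop
        (max (max R (|(zMap (hFun b) G 1).im| / k)) (-(zMap (hFun b) G 0).re) +
          |(zMap (hFun b) G 1).im|))).exists
    have hxH := ofReal_mem_rightHalfPlane (zero_lt_one.trans_le hx1)
    have h1 := Complex.norm_le_abs_re_add_abs_im (zMap (hFun b) G x)
    rw [him x hx1] at h1
    have h2 : max (max R (|(zMap (hFun b) G 1).im| / k)) (-(zMap (hFun b) G 0).re) <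
        |(zMap (hFun b) G x).re| := by linarith
    obtain ⟨h3, h4⟩ := max_lt_iff.1 h2
    obtain ⟨h5, h6⟩ := max_lt_iff.1 h3
    have h7 := re_zMap_zero_le hb0 hb1 hG hc hxH
    have h8 : |(zMap (hFun b) G x).re| = (zMap (hFun b) G x).re := by
      refine (abs_choice _).resolve_right fun h => ?_
      linarith
    rw [h8] at h5 h6
    refine ⟨_, ⟨h5, ?_⟩, x, hxH, rfl⟩
    rw [him x hx1]
    rw [div_lt_iff₀ hk] at h6
    linarith
  -- A frontier point `z(iy)` in the sector would need `|y| < Y`, and then its real part is at most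
  -- `R`.
  · rintro v ⟨hv, hvK⟩
    by_contra hn
    have hf : v ∈ frontier (zMap (hFun b) G '' rightHalfPlane) := by
      rw [(isOpen_image_zMap hb0 hb1 hG).frontier_eq]
      exact ⟨hv, hn⟩
    obtain ⟨ζ, hζ, rfl⟩ := exists_of_mem_frontier hb0 hb1 hG hc hf
    have hζn : ‖ζ‖ = |ζ.im| := by
      rw [Complex.norm_eq_sqrt_sq_add_sq, hζ]
      simp [Real.sqrt_sq_eq_abs]
    have h1 := norm_zMap_sub_le hb0 hb1 hG hc (ζ := ζ) hζ.ge
    rw [hζn] at h1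
    have h2 := (Complex.re_le_norm _).trans h1
    have h3 := (Complex.abs_im_le_norm _).trans h1
    simp only [Complex.sub_re, Complex.sub_im, Complex.mul_re, Complex.mul_im, Complex.ofReal_re,
      Complex.ofReal_im, Complex.I_re, Complex.I_im, Complex.re_ofNat, Complex.im_ofNat, mul_zero,
      mul_one, zero_mul, sub_zero, add_zero, sub_self] at h2 h3
    have h4 := Complex.re_le_norm (zMap (hFun b) G 0)
    have h5 := Complex.abs_im_le_norm (zMap (hFun b) G 0)
    rw [← hA] at h4 h5
    have hre : (zMap (hFun b) G ζ).re ≤ A + 2 / b * |ζ.im| ^ b := by linarith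
    have him : 2 * |ζ.im| ≤ |(zMap (hFun b) G ζ).im| + A + 2 / b * |ζ.im| ^ b := by
      have e : (2 : ℝ) * |ζ.im| = |2 * ζ.im| := by rw [abs_mul, abs_two]
      rw [e]
      have e2 : 2 * ζ.im = (zMap (hFun b) G ζ).im - (zMap (hFun b) G 0).im -
        ((zMap (hFun b) G ζ).im - (zMap (hFun b) G 0).im - 2 * ζ.im) := by ring
      have := abs_sub ((zMap (hFun b) G ζ).im - (zMap (hFun b) G 0).im)
        ((zMap (hFun b) G ζ).im - (zMap (hFun b) G 0).im - 2 * ζ.im)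
      rw [← e2] at this
      have := abs_sub (zMap (hFun b) G ζ).im (zMap (hFun b) G 0).im
      linarith
    have hlt : |ζ.im| < Y := by
      by_contra hge
      have h6 := hY _ (not_lt.1 hge)
      have h7 := mul_le_mul_of_nonneg_left hre hk.le
      have h8 := hvK.2
      linarith
    have h9 : |ζ.im| ^ b ≤ (max Y 0) ^ b :=
      Real.rpow_le_rpow (abs_nonneg _) (hlt.le.trans (le_max_left _ _)) hb0.le
    have h10 : A + 2 / b * |ζ.im| ^ b ≤ R := by
      refine le_max_of_le_right ?_
      gcongr
    exact absurd hvK.1 (not_lt.2 (hre.trans h10))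

theorem asymptoticAngle_eq_pi {D : Set ℂ} {c : ℝ} (hc : ∀ w ∈ D, c < w.re)
    (hD : ∀ k : ℝ, 0 < k → ∃ R : ℝ, ∀ w : ℂ, R < w.re → |w.im| ≤ k * w.re → w ∈ D) :
    asymptoticAngle D = ENNReal.ofReal Real.pi := by
  have hre : ∀ r θ : ℝ, ((r : ℂ) * Complex.exp (θ * Complex.I)).re = r * Real.cos θ := by
    intro r θ
    rw [Complex.re_ofReal_mul, Complex.exp_ofReal_mul_I_re]
  have him : ∀ r θ : ℝ, ((r : ℂ) * Complex.exp (θ * Complex.I)).im = r * Real.sin θ := by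
    intro r θ
    rw [Complex.im_ofReal_mul, Complex.exp_ofReal_mul_I_im]
  have hstar : ∀ᶠ r : ℝ in atTop, angularMeasureStar D r = angularMeasure D r := by
    filter_upwards [eventually_gt_atTop |c|] with r hr
    refine if_neg fun hs => ?_
    have hr0 : 0 ≤ r := (abs_nonneg c).trans hr.le
    have := hc _ (hs (show (-(r : ℂ)) ∈ Metric.sphere (0 : ℂ) r by
      simpa using hr0))
    rw [Complex.neg_re, Complex.ofReal_re] at this
    linarith [neg_abs_le c]
  have hupper : ∀ δ ∈ Ioo 0 (Real.pi / 2), ∀ᶠ r : ℝ in atTop,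
      angularMeasure D r ≤ ENNReal.ofReal (Real.pi + 2 * δ) := by
    intro δ hδ
    have hsin : 0 < Real.sin δ := Real.sin_pos_of_pos_of_lt_pi hδ.1 (by linarith [hδ.2, hδ.1])
    -- If `|θ| > π/2 + δ`, then `r cos θ ≤ -r sin δ ≤ c`, which leaves the half-plane.
    filter_upwards [eventually_ge_atTop (-c / Real.sin δ), eventually_ge_atTop 0] with r hr hr0
    have hsub : {θ : ℝ | θ ∈ Ioc (-Real.pi) Real.pi ∧
        (r : ℂ) * Complex.exp (θ * Complex.I) ∈ D} ⊆
        Icc (-(Real.pi / 2 + δ)) (Real.pi / 2 + δ) := by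
      rintro θ ⟨hθ, hθD⟩
      rw [mem_Icc, ← abs_le]
      by_contra! hlt
      have h1 := hc _ hθD
      rw [hre, ← Real.cos_abs] at h1
      have h2 : Real.cos |θ| ≤ Real.cos (Real.pi / 2 + δ) :=
        Real.cos_le_cos_of_nonneg_of_le_pi (by linarith [hδ.1, Real.pi_pos])
          (abs_le.2 ⟨hθ.1.le, hθ.2⟩) hlt.le
      rw [add_comm (Real.pi / 2), Real.cos_add_pi_div_two] at h2
      rw [div_le_iff₀ hsin] at hr
      have h3 := mul_le_mul_of_nonneg_left h2 hr0
      linarith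
    refine (measure_mono hsub).trans_eq ?_
    rw [Real.volume_Icc]
    congr 1
    ring
  have hlower : ∀ δ ∈ Ioo 0 (Real.pi / 2), ∀ᶠ r : ℝ in atTop,
      ENNReal.ofReal (Real.pi - 2 * δ) ≤ angularMeasure D r := by
    intro δ hδ
    have hsin : 0 < Real.sin δ := Real.sin_pos_of_pos_of_lt_pi hδ.1 (by linarith [hδ.2, hδ.1])
    -- For `|θ| ≤ π/2 - δ` one has `Re w ≥ r sin δ` and `|Im w| ≤ r`, so slope `1/sin δ` suffices.
    obtain ⟨R, hR⟩ := hD (Real.sin δ)⁻¹ (inv_pos.2 hsin)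
    filter_upwards [eventually_gt_atTop (R / Real.sin δ), eventually_ge_atTop 0] with r hr hr0
    have hsub : Icc (-(Real.pi / 2 - δ)) (Real.pi / 2 - δ) ⊆
        {θ : ℝ | θ ∈ Ioc (-Real.pi) Real.pi ∧ (r : ℂ) * Complex.exp (θ * Complex.I) ∈ D} := by
      intro θ hθ
      have hcos : Real.sin δ ≤ Real.cos θ := by
        rw [← Real.cos_abs, ← Real.cos_pi_div_two_sub]
        exact Real.cos_le_cos_of_nonneg_of_le_pi (abs_nonneg _)
          (by linarith [hδ.1, Real.pi_pos]) (abs_le.2 hθ)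
      refine ⟨⟨?_, ?_⟩, hR _ ?_ ?_⟩
      · linarith [hθ.1, hδ.1, Real.pi_pos]
      · linarith [hθ.2, hδ.1, Real.pi_pos]
      · rw [hre]
        rw [div_lt_iff₀ hsin] at hr
        exact hr.trans_le (mul_le_mul_of_nonneg_left hcos hr0)
      · rw [hre, him, abs_mul, abs_of_nonneg hr0, inv_mul_eq_div, le_div_iff₀ hsin]
        calc r * |Real.sin θ| * Real.sin δ ≤ r * 1 * Real.cos θ := by
              gcongr
              exact Real.abs_sin_le_one θ
          _ = r * Real.cos θ := by ring
    refine le_trans (le_of_eq ?_) (measure_mono hsub)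
    rw [Real.volume_Icc]
    congr 1
    ring
  have hmem : Ioo 0 (Real.pi / 2) ∈ 𝓝[>] (0 : ℝ) := Ioo_mem_nhdsGT (by positivity)
  have hlim : ∀ s : ℝ, Tendsto (fun δ : ℝ => ENNReal.ofReal (Real.pi + s * δ)) (𝓝[>] 0)
      (𝓝 (ENNReal.ofReal Real.pi)) := by
    intro s
    have : Continuous fun δ : ℝ => ENNReal.ofReal (Real.pi + s * δ) :=
      ENNReal.continuous_ofReal.comp (by fun_prop)
    simpa using (this.tendsto 0).mono_left nhdsWithin_le_nhds
  have ht : Tendsto (angularMeasure D) atTop (𝓝 (ENNReal.ofReal Real.pi)) := by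
    refine tendsto_order.2 ⟨fun a ha => ?_, fun a ha => ?_⟩
    · obtain ⟨δ, h1, h2⟩ := (((hlim (-2)).eventually_const_lt ha).and hmem).exists
      filter_upwards [hlower δ h2] with r hr
      refine lt_of_lt_of_le ?_ hr
      rwa [neg_mul, ← sub_eq_add_neg] at h1
    · obtain ⟨δ, h1, h2⟩ := (((hlim 2).eventually_lt_const ha).and hmem).exists
      filter_upwards [hupper δ h2] with r hr
      exact hr.trans_lt h1
  exact (ht.congr' (hstar.mono fun _ h => h.symm)).limsup_eq

theorem mainTheorem4 (ρ : ℝ) (hρ : 1 < ρ) :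
    (∃ G : ℂ → ℂ, IsAntiderivInv (hFun (1 / ρ)) G) ∧
    ∀ G : ℂ → ℂ, IsAntiderivInv (hFun (1 / ρ)) G →
      InnerProductSpace.HarmonicOnNhd (zMap (hFun (1 / ρ)) G) rightHalfPlane ∧
      Set.InjOn (zMap (hFun (1 / ρ)) G) rightHalfPlane ∧
      ∃ D : Set ℂ, D = zMap (hFun (1 / ρ)) G '' rightHalfPlane ∧
        (∃ c : ℝ, ∀ w ∈ D, c < w.re) ∧
        asymptoticAngle D = ENNReal.ofReal Real.pi ∧
        ∃ u : ℂ → ℝ,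
          (∀ ζ ∈ rightHalfPlane, u (zMap (hFun (1 / ρ)) G ζ) = 2 * ζ.re) ∧
          IsPositiveMinimalGraph D u ∧
          (∀ᶠ r : ℝ in Filter.atTop,
            IsGreatest (u '' (D ∩ Metric.sphere 0 r)) (maxOnCircle D u r)) ∧
          growthOrder D u = (ρ : EReal) := by
  have hb0 : 0 < 1 / ρ := one_div_pos.2 (zero_lt_one.trans hρ)
  have hb1 : 1 / ρ < 1 := (div_lt_one (zero_lt_one.trans hρ)).2 hρ
  refine ⟨exists_isAntiderivInv hb0 hb1, fun G hG => ⟨harmonicOnNhd_zMap hb0 hG,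
    injOn_zMap hb0 hb1 hG, _, rfl, ?_⟩⟩
  -- The given `G` is arbitrary off `H`; a continuous `G'` equal to it on `H` gives the same `D` and
  -- usable boundary values.
  obtain ⟨G', hc, he⟩ := hG.exists_continuous hb0 hb1
  have hG' := hG.congr he
  have hz : EqOn (zMap (hFun (1 / ρ)) G) (zMap (hFun (1 / ρ)) G') rightHalfPlane :=
    fun ζ hζ => by simp only [zMap, he hζ]
  rw [hz.image_eq]
  have hhalf : ∀ w ∈ zMap (hFun (1 / ρ)) G' '' rightHalfPlane,
      -- Subtracting `1` turns the weak bound into the strict one.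
      (zMap (hFun (1 / ρ)) G' 0).re - 1 < w.re := by
    rintro _ ⟨ζ, hζ, rfl⟩
    linarith [re_zMap_zero_le hb0 hb1 hG' hc hζ]
  refine ⟨⟨_, hhalf⟩, asymptoticAngle_eq_pi hhalf fun k hk =>
    exists_sector_subset_image_zMap hb0 hb1 hG' hc hk, heightFun (1 / ρ) G', fun ζ hζ => ?_,
    isPositiveMinimalGraph_heightFun hb0 hb1 hG' hc, eventually_isGreatest_heightFun hb0 hb1 hG' hc,
    ?_⟩
  · rw [hz hζ, heightFun_zMap hb0 hb1 hG' hc hζ]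
  · rw [growthOrder_heightFun hb0 hb1 hG' hc, one_div, inv_inv]
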